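/- **Setting.** Consider a discrete memoryless half-duplex multiple access relay channel with finite alphabets: two sources, a relay $R$ and one destination. A block of $l=n+m$ channel uses has two slots, of lengths $n$ and $m$. In the first slot the relay listens; each channel use has transition probability $p(y_R,y_{11}\mid x_{11},x_{21})$, where $x_{i1}$ is the input of source $i$, and $y_R,y_{11}$ are the outputs at the relay and the destination. In the second slot the relay transmits; each channel use has transition probability $p(y_{12}\mid x_{12},x_{22},x_R)$, where $x_{i2}$ is the input of source $i$, $x_R$ that of the relay, and $y_{12}$ is the output at the destination. The two slots are memoryless. Source $i$ encodes a message $W_i$, uniform on a set of $2^{lR_i}$ elements (rounded up) and independent of the other message, into $X_{i1}^n$ and $X_{i2}^m$; the relay input $X_R^m$ is a function of $Y_R^n$; the destination computes $(\hat W_1,\hat W_2)$ from $(Y_{11}^n,Y_{12}^m)$. Fix $0<\beta<1$. The rate pair $(R_1,R_2)$, $R_i\ge 0$, is *achievable* (with slot fraction $\beta$) if for all slot lengths with $l\to\infty$ and $n/l\to\beta$ there are such codes with $\Pr(\hat W_1\ne W_1\text{ or }\hat W_2\neq W_2)\to 0$. Fix a finite alphabet for $\hat Y_R$ and an input distribution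 $p(x_{11})p(x_{21})p(x_{12})p(x_{22})p(x_R)p(\hat y_R\mid y_R)$. All mutual informations below (in bits) refer to the joint laws $$p(x_{11})p(x_{21})p(y_R,y_{11}\mid x_{11},x_{21})p(\hat y_R\mid y_R),\qquad p(x_{12})p(x_{22})p(x_R)p(y_{12}\mid x_{12},x_{22},x_R).$$ A sequence is *$\epsilon$-typical* for a mass function $q$ if the empirical frequency of every symbol $a$ differs from $q(a)$ by at most $\epsilon\, q(a)$; joint typicality of several sequences refers to the corresponding marginal of these laws. **Modified CF scheme** (with constants $0<\epsilon'<\epsilon<1$ and rates $0\le R_S\le R_U$). There are codebooks $x_{i1}^n(w_i)$, $x_{i2}^m(w_i)$, quantization sequences $\hat y_R^n(u)$ whose indices $u$ are partitioned into $2^{lR_S}$ bins $B(s)$ of $2^{l(R_U-R_S)}$ indices each (both numbers rounded up), and relay codewords $x_R^m(s)$. The sources send the codewords of their messages. The relay chooses an index $u$ such that $(y_R^n,\hat y_R^n(u))$ is $\epsilon'$-typical, if there is one (and any index otherwise), and sends $x_R^m(s)$ for the bin $s$ of $u$. The destination decodes successively: the unique $\hat s$ such that $(x_R^m(\hat s),y_{12}^m)$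 is $\epsilon$-typical; the unique $\hat u\in B(\hat s)$ such that $(y_{11}^n,\hat y_R^n(\hat u))$ is $\epsilon$-typical; and the unique $(\hat w_1,\hat w_2)$ such that $(x_{11}^n(\hat w_1),x_{21}^n(\hat w_2),y_{11}^n,\hat y_R^n(\hat u))$ and $(x_{12}^m(\hat w_1),x_{22}^m(\hat w_2),x_R^m(\hat s),y_{12}^m)$ are both $\epsilon$-typical. If a step fails, it outputs a fixed message pair. **Theorem 3.** Let $$a_1(i)=\beta I(X_{i1};X_{j1},Y_{11},\hat Y_R)+(1-\beta)I(X_{i2};X_{j2},X_R,Y_{12}),\qquad \{i,j\}=\{1,2\},$$ $$c_1=\beta I(X_{11},X_{21};Y_{11},\hat Y_R)+(1-\beta)I(X_{12},X_{22};X_R,Y_{12}).$$ For every input distribution as above that satisfies $$\beta\,[I(Y_R;\hat Y_R)-I(Y_{11};\hat Y_R)]<(1-\beta)\,I(X_R;Y_{12}),$$ every rate pair with $R_1,R_2\ge 0$, $R_1<a_1(1)$, $R_2<a_1(2)$ and $R_1+R_2<c_1$ is achieved by the modified CF scheme: there are constants $0<\epsilon'<\epsilon<1$ and rates $0\le R_S\le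 R_U$ such that for all slot lengths with $l\to\infty$ and $n/l\to\beta$ there are instances of the scheme, with message sets of size $2^{lR_i}$ (rounded up), whose error probability tends to $0$. In particular $(R_1,R_2)$ is achievable. -/

import Mathlib

open Filter Topology

namespace HDMARC

noncomputable section

/-! ### Finite probability: laws of random variables, mutual information, typical sequences -/

open Classical in
/-- The probability mass function of the random variable `f` when the finite sample space `Ω`
carries the mass function `p`. -/
def law {Ω A : Type*} [Fintype Ω] (p : Ω → ℝ) (f : Ω → A) (a : A) : ℝ :=
  ∑ ω, if f ω = a then p ω else 0

/-- The mutual information `I(f; g)`, in bits, of two random variables on `(Ω, p)`: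
`∑ p(a,b) log₂ (p(a,b) / (p(a) p(b)))`. A pair with `p(a,b) = 0` contributes `0`. -/
def mutualInfo {Ω A B : Type*} [Fintype Ω] [Fintype A] [Fintype B]
    (p : Ω → ℝ) (f : Ω → A) (g : Ω → B) : ℝ :=
  ∑ a, ∑ b, law p (fun ω => (f ω, g ω)) (a, b) *
    Real.logb 2 (law p (fun ω => (f ω, g ω)) (a, b) / (law p f a * law p g b))

open Classical in
/-- `x` is `ε`-strongly typical for the mass function `q`: the empirical frequency of every symbol
`a` differs from `q a` by at most `ε * q a`. -/
def Typical {A : Type*} {n : ℕ} (ε : ℝ) (q : A → ℝ) (x : Fin n → A) : Prop :=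
  ∀ a, |(((Finset.univ.filter fun i => x i = a).card : ℝ) / n) - q a| ≤ ε * q a

open Classical in
/-- The unique `a` with property `Q`, or `none` (a decoding failure) if there is no such `a` or
more than one. -/
def theUnique {α : Type*} (Q : α → Prop) : Option α :=
  if h : ∃! a, Q a then some h.choose else none

/-! ### The channel -/

/-- A discrete memoryless half-duplex multiple access relay channel, given by its one-letter
transition probabilities. `Xij` is the input alphabet of source `i` in slot `j`, `XR` the relay
input alphabet (slot 2), `YR` the relay output alphabet (slot 1), and `Y1j` the output alphabet of
the destination in slot `j`. -/
structure Channel (X11 X21 X12 X22 XR YR Y11 Y12 : Type*)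
    [Fintype YR] [Fintype Y11] [Fintype Y12] where
  /-- `p(y_R, y₁₁ | x₁₁, x₂₁)` -/
  slot1 : X11 → X21 → YR × Y11 → ℝ
  slot1_mem : ∀ x₁ x₂, slot1 x₁ x₂ ∈ stdSimplex ℝ (YR × Y11)
  /-- `p(y₁₂ | x₁₂, x₂₂, x_R)` -/
  slot2 : X12 → X22 → XR → Y12 → ℝ
  slot2_mem : ∀ x₁ x₂ xR, slot2 x₁ x₂ xR ∈ stdSimplex ℝ Y12

/-- An input distribution `p(x₁₁) p(x₂₁) p(x₁₂) p(x₂₂) p(x_R) p(ŷ_R | y_R)`. -/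
structure InputDist (X11 X21 X12 X22 XR YR Yh : Type*)
    [Fintype X11] [Fintype X21] [Fintype X12] [Fintype X22] [Fintype XR] [Fintype Yh] where
  p11 : X11 → ℝ
  p11_mem : p11 ∈ stdSimplex ℝ X11
  p21 : X21 → ℝ
  p21_mem : p21 ∈ stdSimplex ℝ X21
  p12 : X12 → ℝ
  p12_mem : p12 ∈ stdSimplex ℝ X12
  p22 : X22 → ℝ
  p22_mem : p22 ∈ stdSimplex ℝ X22
  pR : XR → ℝ
  pR_mem : pR ∈ stdSimplex ℝ XR
  /-- the test channel `p(ŷ_R | y_R)` -/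
  quant : YR → Yh → ℝ
  quant_mem : ∀ y, quant y ∈ stdSimplex ℝ Yh

/-- The number of messages (or indices) of rate `R` in a block of `l` channel uses: `2 ^ (l R)`,
rounded up to an integer. -/
def numIdx (l : ℕ) (R : ℝ) : ℕ := ⌈(2 : ℝ) ^ ((l : ℝ) * R)⌉₊

instance (l : ℕ) (R : ℝ) : NeZero (numIdx l R) :=
  ⟨(Nat.ceil_pos.2 (Real.rpow_pos_of_pos two_pos _)).ne'⟩

section

variable {X11 X21 X12 X22 XR YR Y11 Y12 Yh : Type*}
  [Fintype X11] [Fintype X21] [Fintype X12] [Fintype X22] [Fintype XR]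
  [Fintype YR] [Fintype Y11] [Fintype Y12] [Fintype Yh]

/-- The joint law of `(X₁₁, X₂₁, Y_R, Y₁₁, Ŷ_R)`. -/
def joint1 (W : Channel X11 X21 X12 X22 XR YR Y11 Y12)
    (P : InputDist X11 X21 X12 X22 XR YR Yh) : X11 × X21 × YR × Y11 × Yh → ℝ :=
  fun (x₁, x₂, yR, y, yh) => P.p11 x₁ * P.p21 x₂ * W.slot1 x₁ x₂ (yR, y) * P.quant yR yh

/-- The joint law of `(X₁₂, X₂₂, X_R, Y₁₂)`. -/
def joint2 (W : Channel X11 X21 X12 X22 XR YR Y11 Y12)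
    (P : InputDist X11 X21 X12 X22 XR YR Yh) : X12 × X22 × XR × Y12 → ℝ :=
  fun (x₁, x₂, xR, y) => P.p12 x₁ * P.p22 x₂ * P.pR xR * W.slot2 x₁ x₂ xR y

/-- `β I(X₁₁; X₂₁, Y₁₁, Ŷ_R) + (1 - β) I(X₁₂; X₂₂, X_R, Y₁₂)` -/
def bound1 (W : Channel X11 X21 X12 X22 XR YR Y11 Y12)
    (P : InputDist X11 X21 X12 X22 XR YR Yh) (β : ℝ) : ℝ :=
  β * mutualInfo (joint1 W P) (fun (x₁, _, _, _, _) => x₁) (fun (_, x₂, _, y, yh) => (x₂, y, yh))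
    + (1 - β) * mutualInfo (joint2 W P) (fun (x₁, _, _, _) => x₁)
        (fun (_, x₂, xR, y) => (x₂, xR, y))

/-- `β I(X₂₁; X₁₁, Y₁₁, Ŷ_R) + (1 - β) I(X₂₂; X₁₂, X_R, Y₁₂)` -/
def bound2 (W : Channel X11 X21 X12 X22 XR YR Y11 Y12)
    (P : InputDist X11 X21 X12 X22 XR YR Yh) (β : ℝ) : ℝ :=
  β * mutualInfo (joint1 W P) (fun (_, x₂, _, _, _) => x₂) (fun (x₁, _, _, y, yh) => (x₁, y, yh))
    + (1 - β) * mutualInfo (joint2 W P) (fun (_, x₂, _, _) => x₂)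
        (fun (x₁, _, xR, y) => (x₁, xR, y))

/-- `β I(X₁₁, X₂₁; Y₁₁, Ŷ_R) + (1 - β) I(X₁₂, X₂₂; X_R, Y₁₂)` -/
def boundSum (W : Channel X11 X21 X12 X22 XR YR Y11 Y12)
    (P : InputDist X11 X21 X12 X22 XR YR Yh) (β : ℝ) : ℝ :=
  β * mutualInfo (joint1 W P) (fun (x₁, x₂, _, _, _) => (x₁, x₂)) (fun (_, _, _, y, yh) => (y, yh))
    + (1 - β) * mutualInfo (joint2 W P) (fun (x₁, x₂, _, _) => (x₁, x₂))
        (fun (_, _, xR, y) => (xR, y))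

/-- `I(Y_R; Ŷ_R)` -/
def infoRelayQuant (W : Channel X11 X21 X12 X22 XR YR Y11 Y12)
    (P : InputDist X11 X21 X12 X22 XR YR Yh) : ℝ :=
  mutualInfo (joint1 W P) (fun (_, _, yR, _, _) => yR) (fun (_, _, _, _, yh) => yh)

/-- `I(Y₁₁; Ŷ_R)` -/
def infoDestQuant (W : Channel X11 X21 X12 X22 XR YR Y11 Y12)
    (P : InputDist X11 X21 X12 X22 XR YR Yh) : ℝ :=
  mutualInfo (joint1 W P) (fun (_, _, _, y, _) => y) (fun (_, _, _, _, yh) => yh)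

/-- `I(X_R; Y₁₂)` -/
def infoRelayDest (W : Channel X11 X21 X12 X22 XR YR Y11 Y12)
    (P : InputDist X11 X21 X12 X22 XR YR Yh) : ℝ :=
  mutualInfo (joint2 W P) (fun (_, _, xR, _) => xR) (fun (_, _, _, y) => y)

end

/-! ### Codes and achievability -/

/-- A single-block two-slot code with slot lengths `n` and `m` and with `M₁`, `M₂` messages. -/
structure Code (X11 X21 X12 X22 XR YR Y11 Y12 : Type*) (n m M₁ M₂ : ℕ) where
  enc11 : Fin M₁ → Fin n → X11
  enc21 : Fin M₂ → Fin n → X21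
  enc12 : Fin M₁ → Fin m → X12
  enc22 : Fin M₂ → Fin m → X22
  /-- the relay input in slot 2, a function of the relay reception in slot 1 -/
  relay : (Fin n → YR) → Fin m → XR
  /-- the decoder of the destination, from its receptions in both slots -/
  dec : (Fin n → Y11) → (Fin m → Y12) → Fin M₁ × Fin M₂

section

variable {X11 X21 X12 X22 XR YR Y11 Y12 Yh : Type*}
  [Fintype X11] [Fintype X21] [Fintype X12] [Fintype X22] [Fintype XR]
  [Fintype YR] [Fintype Y11] [Fintype Y12] [Fintype Yh]

/-- `Pr(Ŵ₁ ≠ W₁ or Ŵ₂ ≠ W₂)` for independent uniformly distributed messages `W₁`, `W₂`. -/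
def errorProb {n m M₁ M₂ : ℕ} (W : Channel X11 X21 X12 X22 XR YR Y11 Y12)
    (c : Code X11 X21 X12 X22 XR YR Y11 Y12 n m M₁ M₂) : ℝ :=
  ((M₁ : ℝ) * M₂)⁻¹ * ∑ w₁ : Fin M₁, ∑ w₂ : Fin M₂,
    ∑ yR : Fin n → YR, ∑ y1 : Fin n → Y11, ∑ y2 : Fin m → Y12,
      if c.dec y1 y2 = (w₁, w₂) then 0 else
        (∏ t, W.slot1 (c.enc11 w₁ t) (c.enc21 w₂ t) (yR t, y1 t)) *
          ∏ t, W.slot2 (c.enc12 w₁ t) (c.enc22 w₂ t) (c.relay yR t) (y2 t)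

/-- `(n k)`, `(m k)` are the slot lengths of a sequence of blocks whose length `l = n + m` tends to
infinity and in which the first slot occupies the fraction `β` of the block (in the limit, so that
irrational `β` are covered too). -/
def SlotLengths (β : ℝ) (n m : ℕ → ℕ) : Prop :=
  Tendsto (fun k => n k + m k) atTop atTop ∧
    Tendsto (fun k => (n k : ℝ) / ((n k + m k : ℕ) : ℝ)) atTop (𝓝 β)

/-- The rate pair `(R₁, R₂)` is achievable with slot fraction `β`: for all slot lengths with
fraction `β` there are codes with message sets of size `2 ^ (l Rᵢ)` whose error probability tends
to `0`. -/
def Achievable (W : Channel X11 X21 X12 X22 XR YR Y11 Y12) (β R₁ R₂ : ℝ) : Prop :=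
  ∀ n m : ℕ → ℕ, SlotLengths β n m →
    ∃ c : ∀ k, Code X11 X21 X12 X22 XR YR Y11 Y12 (n k) (m k)
        (numIdx (n k + m k) R₁) (numIdx (n k + m k) R₂),
      Tendsto (fun k => errorProb W (c k)) atTop (𝓝 0)

/-! ### The modified compress-and-forward scheme -/

/-- An instance of the modified compress-and-forward scheme: codebooks of the sources, a codebook of
quantization sequences `ŷ_R(u)`, where the indices `u` are partitioned into `S` bins of `B` elements
each (`u = (s, b)` is in bin `s`), a relay codeword for every bin, and the choice of a
quantization index `u` whose sequence is jointly `ε'`-typical with the relay reception whenever there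
is one. -/
structure CFScheme (W : Channel X11 X21 X12 X22 XR YR Y11 Y12)
    (P : InputDist X11 X21 X12 X22 XR YR Yh) (ε' : ℝ) (n m M₁ M₂ S B : ℕ) where
  x11 : Fin M₁ → Fin n → X11
  x21 : Fin M₂ → Fin n → X21
  x12 : Fin M₁ → Fin m → X12
  x22 : Fin M₂ → Fin m → X22
  yhat : Fin S × Fin B → Fin n → Yh
  xR : Fin S → Fin m → XR
  quantize : (Fin n → YR) → Fin S × Fin B
  quantize_spec : ∀ yR : Fin n → YR,
    (∃ u, Typical ε' (law (joint1 W P) fun (_, _, yR, _, yh) => (yR, yh))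
      fun t => (yR t, yhat u t)) →
    Typical ε' (law (joint1 W P) fun (_, _, yR, _, yh) => (yR, yh))
      fun t => (yR t, yhat (quantize yR) t)

namespace CFScheme

variable {W : Channel X11 X21 X12 X22 XR YR Y11 Y12} {P : InputDist X11 X21 X12 X22 XR YR Yh}
  {ε' : ℝ} {n m M₁ M₂ S B : ℕ}

/-- First decoding step: the unique bin index `s` such that `(x_R(s), y₁₂)` is `ε`-typical. -/
def decBin (c : CFScheme W P ε' n m M₁ M₂ S B) (ε : ℝ) (y2 : Fin m → Y12) : Option (Fin S) :=
  theUnique fun s => Typical ε (law (joint2 W P) fun (_, _, xR, y) => (xR, y))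
    fun t => (c.xR s t, y2 t)

/-- Second decoding step: the unique quantization index `u` in the bin `s` such that
`(y₁₁, ŷ_R(u))` is `ε`-typical. -/
def decQuant (c : CFScheme W P ε' n m M₁ M₂ S B) (ε : ℝ) (y1 : Fin n → Y11) (s : Fin S) :
    Option (Fin S × Fin B) :=
  theUnique fun u => u.1 = s ∧ Typical ε (law (joint1 W P) fun (_, _, _, y, yh) => (y, yh))
    fun t => (y1 t, c.yhat u t)

/-- Third decoding step: the unique message pair that is jointly `ε`-typical with the receptions and
the already decoded indices in both slots. -/
def decMsg (c : CFScheme W P ε' n m M₁ M₂ S B) (ε : ℝ) (y1 : Fin n → Y11) (y2 : Fin m → Y12)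
    (s : Fin S) (u : Fin S × Fin B) : Option (Fin M₁ × Fin M₂) :=
  theUnique fun w =>
    Typical ε (law (joint1 W P) fun (x₁, x₂, _, y, yh) => (x₁, x₂, y, yh))
      (fun t => (c.x11 w.1 t, c.x21 w.2 t, y1 t, c.yhat u t)) ∧
    Typical ε (law (joint2 W P) fun (x₁, x₂, xR, y) => (x₁, x₂, xR, y))
      (fun t => (c.x12 w.1 t, c.x22 w.2 t, c.xR s t, y2 t))

/-- The code that the scheme defines. The relay sends the codeword of the bin of its quantization
index; the destination decodes bin index, quantization index and messages one after the other. If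
a step fails, the destination outputs a fixed message pair. -/
def toCode [NeZero M₁] [NeZero M₂] (c : CFScheme W P ε' n m M₁ M₂ S B) (ε : ℝ) :
    Code X11 X21 X12 X22 XR YR Y11 Y12 n m M₁ M₂ where
  enc11 := c.x11
  enc21 := c.x21
  enc12 := c.x12
  enc22 := c.x22
  relay yR := c.xR (c.quantize yR).1
  dec y1 y2 :=
    ((c.decBin ε y2).bind fun s => (c.decQuant ε y1 s).bind fun u => c.decMsg ε y1 y2 s u).getD
      (0, 0)

end CFScheme

/-- The rate pair `(R₁, R₂)` is achieved with slot fraction `β` by the modified compress-and-forward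
scheme with input distribution `P`: for some typicality constants `ε' < ε`, quantization rate `RU`
and binning rate `RS`, and for all slot lengths with fraction `β`, there are instances of
the scheme with `2 ^ (l Rᵢ)` messages and `2 ^ (l RS)` bins of `2 ^ (l (RU - RS))` indices whose
error probability tends to `0`. -/
def CFAchievable (W : Channel X11 X21 X12 X22 XR YR Y11 Y12)
    (P : InputDist X11 X21 X12 X22 XR YR Yh) (β R₁ R₂ : ℝ) : Prop :=
  ∃ ε' ε RS RU : ℝ, 0 < ε' ∧ ε' < ε ∧ ε < 1 ∧ 0 ≤ RS ∧ RS ≤ RU ∧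
    ∀ n m : ℕ → ℕ, SlotLengths β n m →
      ∃ c : ∀ k, CFScheme W P ε' (n k) (m k)
          (numIdx (n k + m k) R₁) (numIdx (n k + m k) R₂)
          (numIdx (n k + m k) RS) (numIdx (n k + m k) (RU - RS)),
        Tendsto (fun k => errorProb W ((c k).toCode ε)) atTop (𝓝 0)

end

end

end HDMARC

set_option linter.unusedSectionVars false

/-! The proof is random coding. All codewords are drawn independently and letter by letter from the
marginals of the input distribution, and the error probability is averaged over codebooks and
channel. Once this average tends to 0, some choice of codebooks does at least as well
(`exists_errorProb_le`).

For a fixed message pair a decoding error forces one of eight bad events (`ind_dec_ne_le`): no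
quantization sequence fits the relay reception; the true sequences are atypical in slot 1 or in slot
2; a wrong bin, or a wrong index in the correct bin, passes its test; the first message, the second,
or both are wrong and pass the last test. Atypicality has probability O(1/n) or O(1/m) by Chebyshev
(`expect_not_typical_le`). The counting events rest on one identity (`Typical.prod_law_eq`): along a
typical sequence the marginal and the conditional product densities differ by a factor of about
2^(-nI). Read one way it gives `packing`, the other way `covering`.

Covering requires RU > β I(Y_R;Ŷ_R), the bin test RS < (1-β) I(X_R;Y₁₂), and the test within a bin
RU - RS < β I(Y₁₁;Ŷ_R). By the hypothesis on the relay such rates exist, if a rate 0 is admitted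
where the corresponding information vanishes (`exists_relay_rates`). In the message tests the two
slots use independent codewords, so the probabilities multiply and the exponents add up to the three
bounds of the theorem.

Two dependences need care. The chosen sequence ŷ_R is a function of y_R and the whole codebook, so
its typicality with the sources and y₁₁ needs a Markov argument: given y_R, these are generated
without regard to the codebook (`exists_kernel_chan1`, `exists_avg_not_typSlot1_le`). Likewise the
other sequences in the chosen bin are not independent of the choice. The relay therefore takes the
first fitting index, whose position is nearly geometric, and this costs only a factor 2 in the union
bound (`expect_bin_collision_le`). -/

namespace HDMARC

noncomputable section

section

/-! ### Finite expectations -/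

/-- The expectation of `F` under the mass function `p`. -/
def expect {Ω : Type*} [Fintype Ω] (p F : Ω → ℝ) : ℝ := ∑ ω, p ω * F ω

open Classical in
/-- The indicator of a proposition, as a real number. -/
def ind (Q : Prop) : ℝ := if Q then 1 else 0

/-- The joint mass function of an input with mass function `p` and the output of the kernel `K`. -/
def compProd {A B : Type*} (p : A → ℝ) (K : A → B → ℝ) (x : A × B) : ℝ := p x.1 * K x.1 x.2

/-- The mass function of independent random variables `x i` with mass functions `p i`. -/
def piPmf {ι A : Type*} [Fintype ι] (p : ι → A → ℝ) (x : ι → A) : ℝ := ∏ i, p i (x i)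

lemma ind_true {Q : Prop} (h : Q) : ind Q = 1 := if_pos h

lemma ind_false {Q : Prop} (h : ¬ Q) : ind Q = 0 := if_neg h

lemma ind_nonneg (Q : Prop) : 0 ≤ ind Q := by
  unfold ind; split_ifs <;> norm_num

lemma ind_le_one (Q : Prop) : ind Q ≤ 1 := by
  unfold ind; split_ifs <;> norm_num

lemma ind_not (Q : Prop) : ind (¬ Q) = 1 - ind Q := by
  by_cases h : Q <;> simp [ind, h]

lemma ind_and (Q R : Prop) : ind (Q ∧ R) = ind Q * ind R := by
  by_cases h : Q <;> by_cases h' : R <;> simp [ind, h, h']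

lemma ind_mono {Q R : Prop} (h : Q → R) : ind Q ≤ ind R := by
  by_cases hQ : Q
  · rw [ind_true hQ, ind_true (h hQ)]
  · rw [ind_false hQ]; exact ind_nonneg _

lemma ind_or_le (Q R : Prop) : ind (Q ∨ R) ≤ ind Q + ind R := by
  by_cases h : Q <;> by_cases h' : R <;> simp [ind, h, h']

lemma ind_exists_le {α : Type*} (s : Finset α) (Q : α → Prop) :
    ind (∃ a ∈ s, Q a) ≤ ∑ a ∈ s, ind (Q a) := by
  by_cases h : ∃ a ∈ s, Q a
  · obtain ⟨a, ha, hQ⟩ := h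
    refine (ind_le_one _).trans ?_
    rw [← ind_true hQ]
    exact Finset.single_le_sum (f := fun a => ind (Q a)) (fun i _ => ind_nonneg _) ha
  · rw [ind_false h]
    exact Finset.sum_nonneg fun i _ => ind_nonneg _

section expect

variable {Ω A B : Type*} [Fintype Ω] [Fintype A] [Fintype B]

lemma expect_mono {p F G : Ω → ℝ} (hp : p ∈ stdSimplex ℝ Ω) (h : ∀ ω, F ω ≤ G ω) :
    expect p F ≤ expect p G :=
  Finset.sum_le_sum fun ω _ => mul_le_mul_of_nonneg_left (h ω) (hp.1 ω)

lemma expect_const {p : Ω → ℝ} (hp : p ∈ stdSimplex ℝ Ω) (c : ℝ) :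
    expect p (fun _ => c) = c := by
  simp [expect, ← Finset.sum_mul, hp.2]

lemma expect_le {p F : Ω → ℝ} {c : ℝ} (hp : p ∈ stdSimplex ℝ Ω) (h : ∀ ω, F ω ≤ c) :
    expect p F ≤ c :=
  (expect_mono hp h).trans (expect_const hp c).le

lemma expect_nonneg {p F : Ω → ℝ} (hp : p ∈ stdSimplex ℝ Ω) (h : ∀ ω, 0 ≤ F ω) :
    0 ≤ expect p F :=
  Finset.sum_nonneg fun ω _ => mul_nonneg (hp.1 ω) (h ω)

lemma expect_add (p F G : Ω → ℝ) :
    expect p (fun ω => F ω + G ω) = expect p F + expect p G := by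
  simp [expect, mul_add, Finset.sum_add_distrib]

lemma expect_sub (p F G : Ω → ℝ) :
    expect p (fun ω => F ω - G ω) = expect p F - expect p G := by
  simp [expect, mul_sub, Finset.sum_sub_distrib]

lemma expect_sum {ι : Type*} (s : Finset ι) (p : Ω → ℝ) (F : ι → Ω → ℝ) :
    expect p (fun ω => ∑ i ∈ s, F i ω) = ∑ i ∈ s, expect p (F i) := by
  simp only [expect, Finset.mul_sum]
  exact Finset.sum_comm

lemma expect_const_mul (p F : Ω → ℝ) (c : ℝ) :
    expect p (fun ω => c * F ω) = c * expect p F := by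
  simp only [expect, Finset.mul_sum]
  exact Finset.sum_congr rfl fun _ _ => by ring

lemma expect_mul_const (p F : Ω → ℝ) (c : ℝ) :
    expect p (fun ω => F ω * c) = expect p F * c := by
  simp only [expect, Finset.sum_mul]
  exact Finset.sum_congr rfl fun _ _ => by ring

lemma expect_comm (p : A → ℝ) (q : B → ℝ) (F : A → B → ℝ) :
    expect p (fun a => expect q (fun b => F a b)) =
      expect q (fun b => expect p (fun a => F a b)) := by
  simp only [expect, Finset.mul_sum]
  rw [Finset.sum_comm]
  exact Finset.sum_congr rfl fun _ _ => Finset.sum_congr rfl fun _ _ => by ring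

/-- This is how independence is used throughout: a variable whose law does not involve `a` may be
fixed at its worst value before `a` is averaged. -/
lemma expect_swap_le {p : A → ℝ} {q : B → ℝ} {F : A → B → ℝ} {c : ℝ} (hq : q ∈ stdSimplex ℝ B)
    (h : ∀ b, expect p (fun a => F a b) ≤ c) :
    expect p (fun a => expect q (fun b => F a b)) ≤ c := by
  rw [expect_comm]
  exact expect_le hq h

lemma exists_le_expect {p : Ω → ℝ} (hp : p ∈ stdSimplex ℝ Ω) (F : Ω → ℝ) :
    ∃ ω, F ω ≤ expect p F := by
  by_contra! h
  have hlt : ∑ ω, p ω * expect p F < ∑ ω, p ω * F ω := by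
    refine Finset.sum_lt_sum (fun ω _ => mul_le_mul_of_nonneg_left (h ω).le (hp.1 ω)) ?_
    by_contra! h'
    have h0 : ∀ ω, p ω = 0 := by
      intro ω
      by_contra hne
      have hpos : 0 < p ω := lt_of_le_of_ne (hp.1 ω) (Ne.symm hne)
      exact absurd (h' ω (Finset.mem_univ _)) (not_le.2 (mul_lt_mul_of_pos_left (h ω) hpos))
    have := hp.2
    simp [h0] at this
  rw [← Finset.sum_mul, hp.2, one_mul] at hlt
  exact lt_irrefl _ hlt

lemma expect_compProd (p : A → ℝ) (K : A → B → ℝ) (F : A × B → ℝ) :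
    expect (compProd p K) F = expect p (fun a => expect (K a) (fun b => F (a, b))) := by
  simp only [expect, compProd, Fintype.sum_prod_type, Finset.mul_sum, mul_assoc]

lemma compProd_mem {p : A → ℝ} {K : A → B → ℝ} (hp : p ∈ stdSimplex ℝ A)
    (hK : ∀ a, K a ∈ stdSimplex ℝ B) : compProd p K ∈ stdSimplex ℝ (A × B) := by
  refine ⟨fun x => mul_nonneg (hp.1 _) ((hK _).1 _), ?_⟩
  simp only [compProd, Fintype.sum_prod_type, ← Finset.mul_sum, (hK _).2, mul_one, hp.2]

/-! ### Laws -/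

lemma law_eq_expect (p : Ω → ℝ) {A : Type*} (f : Ω → A) (a : A) :
    law p f a = expect p (fun ω => ind (f ω = a)) := by
  unfold law expect ind
  exact Finset.sum_congr rfl fun ω _ => by by_cases h : f ω = a <;> simp [h]

lemma expect_law (p : Ω → ℝ) (f : Ω → A) (F : A → ℝ) :
    expect (law p f) F = expect p (fun ω => F (f ω)) := by
  classical
  simp only [expect, law, Finset.sum_mul]
  rw [Finset.sum_comm]
  refine Finset.sum_congr rfl fun ω _ => ?_
  rw [Finset.sum_eq_single (f ω)]
  · simp
  · intro b _ hb; simp [Ne.symm hb]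
  · simp

lemma law_mem {p : Ω → ℝ} (hp : p ∈ stdSimplex ℝ Ω) (f : Ω → A) : law p f ∈ stdSimplex ℝ A := by
  refine ⟨fun a => ?_, ?_⟩
  · rw [law_eq_expect]; exact expect_nonneg hp fun _ => ind_nonneg _
  · have := expect_law p f (fun _ => 1)
    rw [expect_const hp] at this
    simpa [expect] using this

lemma law_law (p : Ω → ℝ) (f : Ω → A) {C : Type*} (g : A → C) :
    law (law p f) g = law p (fun ω => g (f ω)) := by
  funext c
  rw [law_eq_expect, expect_law, law_eq_expect]

lemma law_nonneg {p : Ω → ℝ} (hp : p ∈ stdSimplex ℝ Ω) {A : Type*} (f : Ω → A) (a : A) :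
    0 ≤ law p f a := by
  rw [law_eq_expect]; exact expect_nonneg hp fun _ => ind_nonneg _

lemma le_law {p : Ω → ℝ} (hp : p ∈ stdSimplex ℝ Ω) {A : Type*} (f : Ω → A) (ω : Ω) :
    p ω ≤ law p f (f ω) := by
  classical
  unfold law
  calc p ω = if f ω = f ω then p ω else 0 := by simp
    _ ≤ _ := Finset.single_le_sum (f := fun ω' => if f ω' = f ω then p ω' else 0)
      (fun i _ => by split_ifs <;> simp [hp.1 i]) (Finset.mem_univ ω)

lemma mutualInfo_law (p : Ω → ℝ) (h : Ω → A) {C D : Type*} [Fintype C] [Fintype D]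
    (f : A → C) (g : A → D) :
    mutualInfo (law p h) f g = mutualInfo p (fun ω => f (h ω)) (fun ω => g (h ω)) := by
  simp only [mutualInfo, law_law]

lemma law_equiv (p : Ω → ℝ) (e : Ω ≃ A) (a : A) : law p e a = p (e.symm a) := by
  classical
  unfold law
  rw [Finset.sum_eq_single (e.symm a)]
  · simp
  · intro b _ hb
    rw [if_neg]
    rintro rfl
    simp at hb
  · simp

lemma law_compProd_fst (p : A → ℝ) {K : A → B → ℝ} (hK : ∀ a, K a ∈ stdSimplex ℝ B) :
    law (compProd p K) Prod.fst = p := by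
  classical
  funext a
  rw [law_eq_expect, expect_compProd]
  simp only [expect_const (hK _)]
  exact (law_eq_expect p id a).symm.trans (law_equiv p (Equiv.refl A) a)

/-- Every joint mass function is the product of its first marginal and a kernel. -/
lemma exists_kernel {q : A × B → ℝ} (hq : q ∈ stdSimplex ℝ (A × B)) :
    ∃ k : A → B → ℝ, (∀ a, k a ∈ stdSimplex ℝ B) ∧ q = compProd (law q Prod.fst) k := by
  classical
  have hsum : ∀ a, law q Prod.fst a = ∑ b, q (a, b) := by
    intro a
    unfold law
    rw [Fintype.sum_prod_type, Finset.sum_eq_single a]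
    · simp
    · intro b _ hb; simp [hb]
    · simp
  -- On symbols of mass 0 the kernel is irrelevant, but it must still be a mass function; the second
  -- marginal is one that is at hand.
  refine ⟨fun a => if law q Prod.fst a = 0 then law q Prod.snd else
    fun b => q (a, b) / law q Prod.fst a, fun a => ?_, ?_⟩
  · dsimp only
    split_ifs with h
    · exact law_mem hq _
    · refine ⟨fun b => div_nonneg (hq.1 _) (law_nonneg hq _ _), ?_⟩
      rw [← Finset.sum_div, ← hsum, div_self h]
  · funext ⟨a, b⟩
    unfold compProd
    dsimp only
    split_ifs with h
    · rw [h, zero_mul]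
      refine le_antisymm ?_ (hq.1 _)
      rw [← h]
      exact le_law hq Prod.fst (a, b)
    · rw [mul_div_cancel₀ _ h]

end expect

/-! ### Independent random variables -/

section pi

variable {ι A B : Type*} [Fintype ι] [DecidableEq ι] [Fintype A] [Fintype B]

lemma expect_pi_prod (p φ : ι → A → ℝ) :
    expect (piPmf p) (fun x => ∏ i, φ i (x i)) = ∏ i, expect (p i) (φ i) := by
  simp only [expect, piPmf, ← Finset.prod_mul_distrib]
  rw [Finset.prod_univ_sum, Fintype.piFinset_univ]

lemma piPmf_mem {p : ι → A → ℝ} (hp : ∀ i, p i ∈ stdSimplex ℝ A) :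
    piPmf p ∈ stdSimplex ℝ (ι → A) := by
  refine ⟨fun x => Finset.prod_nonneg fun i _ => (hp i).1 _, ?_⟩
  have := expect_pi_prod p (fun _ _ => 1)
  simpa [expect, (hp _).2] using this

/-- Exchanging a fresh symbol with the one at `i` is an involution, and by this identity it
preserves the product weight. That is what makes resampling a coordinate legitimate. -/
lemma piPmf_update_mul (p : ι → A → ℝ) (x : ι → A) (i : ι) (a : A) :
    p i (x i) * piPmf p (Function.update x i a) = p i a * piPmf p x := by
  unfold piPmf
  rw [← Finset.mul_prod_erase _ _ (Finset.mem_univ i),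
    ← Finset.mul_prod_erase _ (fun j => p j (x j)) (Finset.mem_univ i)]
  have : ∏ j ∈ Finset.univ.erase i, p j (Function.update x i a j) =
      ∏ j ∈ Finset.univ.erase i, p j (x j) :=
    Finset.prod_congr rfl fun j hj => by
      rw [Function.update_of_ne (Finset.ne_of_mem_erase hj)]
  rw [this, Function.update_self]
  ring

/-- The value at the index `i` can be drawn afresh. -/
lemma expect_pi_split {p : ι → A → ℝ} (hp : ∀ i, p i ∈ stdSimplex ℝ A) (i : ι) (F : (ι → A) → ℝ) :
    expect (piPmf p) F =
      expect (p i) (fun a => expect (piPmf p) (fun x => F (Function.update x i a))) := by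
  have h1 : expect (piPmf p) F = ∑ y : A × (ι → A), p i y.1 * (piPmf p y.2 * F y.2) := by
    rw [Fintype.sum_prod_type]
    simp only [← Finset.mul_sum]
    rw [← Finset.sum_mul, (hp i).2, one_mul]
    rfl
  have h2 : expect (p i) (fun a => expect (piPmf p) (fun x => F (Function.update x i a))) =
      ∑ y : A × (ι → A), p i y.1 * (piPmf p y.2 * F (Function.update y.2 i y.1)) := by
    simp only [expect, Fintype.sum_prod_type, Finset.mul_sum]
  rw [h1, h2]
  refine Finset.sum_nbij' (fun y => (y.2 i, Function.update y.2 i y.1))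
    (fun y => (y.2 i, Function.update y.2 i y.1)) ?_ ?_ ?_ ?_ ?_
  · simp
  · simp
  · intro y _; simp
  · intro y _; simp
  · intro y _
    simp only [Function.update_idem, Function.update_eq_self]
    rw [← mul_assoc, ← mul_assoc, piPmf_update_mul]

lemma expect_pi_eval {p : ι → A → ℝ} (hp : ∀ i, p i ∈ stdSimplex ℝ A) (i : ι) (F : A → ℝ) :
    expect (piPmf p) (fun x => F (x i)) = expect (p i) F := by
  rw [expect_pi_split hp i]
  simp [expect_const (piPmf_mem hp)]

/-- Memorylessness: independent pairs may be drawn as one whole block of inputs followed by a block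
of outputs, since the product of the letterwise factors splits. -/
lemma expect_pi_compProd (p : ι → A → ℝ) (K : ι → A → B → ℝ) (F : (ι → A × B) → ℝ) :
    expect (piPmf fun i => compProd (p i) (K i)) F =
      expect (piPmf p) (fun x => expect (piPmf fun i => K i (x i))
        (fun y => F (fun i => (x i, y i)))) := by
  unfold expect
  rw [← Equiv.sum_comp (Equiv.arrowProdEquivProdArrow ι (fun _ => A) (fun _ => B)).symm, Fintype.sum_prod_type]
  simp only [Finset.mul_sum]
  refine Finset.sum_congr rfl fun x _ => Finset.sum_congr rfl fun y _ => ?_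
  simp only [piPmf, compProd, Finset.prod_mul_distrib, mul_assoc]
  rfl

lemma law_pi (q : A → ℝ) (f : A → B) :
    law (piPmf fun _ : ι => q) (fun x i => f (x i)) = piPmf (fun _ : ι => law q f) := by
  funext y
  rw [law_eq_expect]
  have : ∀ x : ι → A, ind ((fun i => f (x i)) = y) = ∏ i, ind (f (x i) = y i) := by
    intro x
    by_cases h : (fun i => f (x i)) = y
    · rw [ind_true h]
      symm
      exact Finset.prod_eq_one fun i _ => ind_true (congrFun h i)
    · rw [ind_false h]
      obtain ⟨i, hi⟩ := Function.ne_iff.1 h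
      symm
      exact Finset.prod_eq_zero (Finset.mem_univ i) (ind_false hi)
  simp only [this]
  rw [expect_pi_prod (fun _ : ι => q) (fun i a => ind (f a = y i))]
  simp only [piPmf, law_eq_expect]

lemma expect_pi_law (q : A → ℝ) (f : A → B) (F : (ι → B) → ℝ) :
    expect (piPmf fun _ : ι => law q f) F =
      expect (piPmf fun _ : ι => q) (fun x => F (fun i => f (x i))) := by
  rw [← law_pi, expect_law]

/-- Sums of independent centred random variables: the variances add up. -/
lemma expect_pi_sq_sum {p : ι → A → ℝ} (hp : ∀ i, p i ∈ stdSimplex ℝ A) (g : ι → A → ℝ)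
    (hg : ∀ i, expect (p i) (g i) = 0) :
    expect (piPmf p) (fun x => (∑ i, g i (x i)) ^ 2) = ∑ i, expect (p i) (fun a => g i a ^ 2) := by
  simp only [sq, Finset.sum_mul_sum, expect_sum]
  refine Finset.sum_congr rfl fun i _ => ?_
  rw [Finset.sum_eq_single i]
  · exact expect_pi_eval hp i (fun a => g i a * g i a)
  · intro j _ hj
    -- A cross term vanishes: once coordinate `i` is resampled, the factor `g i` averages to 0
    -- independently of the factor at `j`.
    rw [expect_pi_split hp i]
    simp only [Function.update_self, Function.update_of_ne hj]
    simp only [expect_const_mul, expect_mul_const, hg, zero_mul]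
  · simp

/-- The union bound over all indices but one. -/
lemma expect_pi_exists_le {p : ι → A → ℝ} (hp : ∀ i, p i ∈ stdSimplex ℝ A) (i₀ : ι)
    (T : A → Prop) {r : ℝ} (hr : ∀ i, expect (p i) (fun a => ind (T a)) ≤ r) :
    expect (piPmf p) (fun x => ind (∃ i, i ≠ i₀ ∧ T (x i))) ≤ ((Fintype.card ι : ℝ) - 1) * r := by
  have h1 : ∀ x : ι → A, ind (∃ i, i ≠ i₀ ∧ T (x i)) ≤
      ∑ i ∈ Finset.univ.erase i₀, ind (T (x i)) := by
    intro x
    refine (ind_mono ?_).trans (ind_exists_le (Finset.univ.erase i₀) fun i => T (x i))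
    rintro ⟨i, hi, hT⟩
    exact ⟨i, by simp [hi], hT⟩
  refine (expect_mono (piPmf_mem hp) h1).trans ?_
  rw [expect_sum]
  refine (Finset.sum_le_card_nsmul _ _ r fun i _ => ?_).trans ?_
  · rw [expect_pi_eval hp i (fun a => ind (T a))]; exact hr i
  · rw [Finset.card_erase_of_mem (Finset.mem_univ _), Finset.card_univ, nsmul_eq_mul,
      Nat.cast_sub (Fintype.card_pos_iff.2 ⟨i₀⟩), Nat.cast_one]

end pi

end

section

/-! ### Typical sequences -/

section typical

variable {A B C D : Type*} [Fintype A] [Fintype B] [Fintype C] [Fintype D] {n : ℕ}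

lemma typical_iff {ε : ℝ} {q : A → ℝ} {x : Fin n → A} :
    Typical ε q x ↔ ∀ a, |(∑ i, ind (x i = a)) / n - q a| ≤ ε * q a := by
  unfold Typical
  refine forall_congr' fun a => ?_
  simp [ind]

/-- Grouping the average by symbol values turns it into an integral against the empirical
distribution. Because the tolerance is proportional to the mass, the errors sum to a multiple of the
mean of `|φ|`. -/
lemma Typical.abs_avg_sub_le {ε : ℝ} {q : A → ℝ} {x : Fin n → A} (h : Typical ε q x)
    (φ : A → ℝ) :
    |(∑ i, φ (x i)) / n - expect q φ| ≤ ε * expect q (fun a => |φ a|) := by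
  classical
  rw [typical_iff] at h
  have h1 : ∑ i, φ (x i) = ∑ a, (∑ i, ind (x i = a)) * φ a := by
    simp only [Finset.sum_mul]
    rw [Finset.sum_comm]
    refine Finset.sum_congr rfl fun i _ => ?_
    rw [Finset.sum_eq_single (x i)]
    · rw [ind_true rfl, one_mul]
    · intro b _ hb; rw [ind_false (Ne.symm hb), zero_mul]
    · simp
  have h2 : (∑ i, φ (x i)) / n - expect q φ =
      ∑ a, ((∑ i, ind (x i = a)) / n - q a) * φ a := by
    rw [h1, Finset.sum_div, expect, ← Finset.sum_sub_distrib]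
    exact Finset.sum_congr rfl fun a _ => by ring
  rw [h2, expect, Finset.mul_sum]
  refine (Finset.abs_sum_le_sum_abs _ _).trans (Finset.sum_le_sum fun a _ => ?_)
  rw [abs_mul, ← mul_assoc]
  exact mul_le_mul_of_nonneg_right (h a) (abs_nonneg _)

lemma Typical.abs_sum_sub_le {ε : ℝ} {q : A → ℝ} {x : Fin n → A} (h : Typical ε q x)
    (φ : A → ℝ) :
    |∑ i, φ (x i) - n * expect q φ| ≤ n * (ε * expect q (fun a => |φ a|)) := by
  rcases Nat.eq_zero_or_pos n with rfl | hn
  · simp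
  · have hn' : (0 : ℝ) < n := Nat.cast_pos.2 hn
    have h1 : ∑ i, φ (x i) - n * expect q φ = n * ((∑ i, φ (x i)) / n - expect q φ) := by
      field_simp
    rw [h1, abs_mul, abs_of_pos hn']
    exact mul_le_mul_of_nonneg_left (h.abs_avg_sub_le φ) hn'.le

/-- Proportional tolerances add up exactly over a fibre, so marginals inherit typicality with the
same constant. -/
lemma Typical.map {ε : ℝ} {q : A → ℝ} {x : Fin n → A} (h : Typical ε q x) (f : A → B) :
    Typical ε (law q f) (fun i => f (x i)) := by
  rw [typical_iff]
  intro b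
  have := h.abs_avg_sub_le (fun a => ind (f a = b))
  simpa only [law_eq_expect, abs_of_nonneg (ind_nonneg _)] using this

/-- A symbol of mass 0 has tolerance 0 and hence never occurs. All logarithms and quotients along a
typical sequence are therefore genuine. -/
lemma Typical.pos {ε : ℝ} {q : A → ℝ} {x : Fin n → A} (h : Typical ε q x)
    (hq : q ∈ stdSimplex ℝ A) (i : Fin n) : 0 < q (x i) := by
  rcases (hq.1 (x i)).lt_or_eq with h0 | h0
  · exact h0
  · exfalso
    have h1 := typical_iff.1 h (x i)
    rw [← h0] at h1
    have hn : (0 : ℝ) < n := Nat.cast_pos.2 i.pos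
    have h2 : (0 : ℝ) < ∑ j, ind (x j = x i) :=
      lt_of_lt_of_le one_pos (by
        rw [← ind_true (rfl : x i = x i)]
        exact Finset.single_le_sum (f := fun j => ind (x j = x i)) (fun j _ => ind_nonneg _)
          (Finset.mem_univ i))
    have h3 : 0 < (∑ j, ind (x j = x i)) / (n : ℝ) := div_pos h2 hn
    rw [mul_zero, sub_zero, abs_of_pos h3] at h1
    linarith

/-- The variance term in the Chebyshev bound for conditional typicality. -/
def chebyshevConst (q : A → ℝ) (η : ℝ) : ℝ := ∑ a, 1 / (η * q a) ^ 2

lemma chebyshevConst_nonneg (q : A → ℝ) (η : ℝ) : 0 ≤ chebyshevConst q η :=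
  Finset.sum_nonneg fun _ _ => by positivity

/-- The conditional typicality lemma: the output of a memoryless kernel with typical input is
jointly typical with the input, up to probability `O(1 / n)`. -/
lemma expect_not_typical_le {qC : C → ℝ} {k : C → D → ℝ} (hqC : qC ∈ stdSimplex ℝ C)
    (hk : ∀ c, k c ∈ stdSimplex ℝ D) {ε' ε : ℝ} (hε : ε' < ε) (hn : 0 < n)
    {c : Fin n → C} (hc : Typical ε' qC c) :
    expect (piPmf fun t => k (c t)) (fun d => ind (¬ Typical ε (compProd qC k)
      (fun t => (c t, d t)))) ≤ chebyshevConst (compProd qC k) (ε - ε') / n := by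
  classical
  have hn' : (0 : ℝ) < n := Nat.cast_pos.2 hn
  have hpi := piPmf_mem (fun t => hk (c t))
  set q := compProd qC k with hq
  have hqmem : q ∈ stdSimplex ℝ (C × D) := compProd_mem hqC hk
  have hunion : ∀ d : Fin n → D, ind (¬ Typical ε q (fun t => (c t, d t))) ≤
      ∑ a, ind (¬ |(∑ i, ind ((c i, d i) = a)) / n - q a| ≤ ε * q a) := by
    intro d
    refine (ind_mono ?_).trans (ind_exists_le Finset.univ
      fun a => ¬ |(∑ i, ind ((c i, d i) = a)) / n - q a| ≤ ε * q a)
    intro h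
    rw [typical_iff] at h
    push Not at h
    obtain ⟨a, ha⟩ := h
    exact ⟨a, Finset.mem_univ _, not_le.2 ha⟩
  refine (expect_mono hpi hunion).trans ?_
  rw [expect_sum, chebyshevConst, Finset.sum_div]
  refine Finset.sum_le_sum fun a _ => ?_
  obtain ⟨c₀, d₀⟩ := a
  set X : Fin n → D → ℝ := fun t d => ind ((c t, d) = (c₀, d₀)) with hX
  have hmean : ∀ t, expect (k (c t)) (X t) = ind (c t = c₀) * k c₀ d₀ := by
    intro t
    by_cases h : c t = c₀
    · rw [ind_true h, one_mul, h]
      have h2 := law_equiv (k c₀) (Equiv.refl D) d₀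
      rw [law_eq_expect] at h2
      simpa [X, h] using h2
    · have : X t = fun _ => 0 := by
        funext d; exact ind_false (by simp [h])
      rw [this, ind_false h, zero_mul, expect_const (hk _)]
  -- Typicality of the input controls the mean frequency within `ε'`; only the gap `ε - ε'` is left
  -- for the fluctuation.
  have hmeansum : |(∑ t, expect (k (c t)) (X t)) / n - q (c₀, d₀)| ≤ ε' * q (c₀, d₀) := by
    simp only [hmean, ← Finset.sum_mul]
    have h1 := typical_iff.1 hc c₀
    have h2 : (∑ i, ind (c i = c₀)) * k c₀ d₀ / n - q (c₀, d₀) =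
        ((∑ i, ind (c i = c₀)) / n - qC c₀) * k c₀ d₀ := by
      simp only [hq, compProd]; ring
    rw [h2, abs_mul, abs_of_nonneg ((hk c₀).1 d₀)]
    calc _ ≤ (ε' * qC c₀) * k c₀ d₀ := mul_le_mul_of_nonneg_right h1 ((hk c₀).1 d₀)
      _ = _ := by simp only [hq, compProd]; ring
  rcases (hqmem.1 (c₀, d₀)).lt_or_eq with h0 | h0
  · -- Chebyshev
    have hη : 0 < (ε - ε') * q (c₀, d₀) := mul_pos (by linarith) h0
    set η := (ε - ε') * q (c₀, d₀) with hηdef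
    set g : Fin n → D → ℝ := fun t d => X t d - expect (k (c t)) (X t) with hg
    have hg0 : ∀ t, expect (k (c t)) (g t) = 0 := by
      intro t
      simp only [hg]
      rw [expect_sub, expect_const (hk _), sub_self]
    have hg1 : ∀ t, expect (k (c t)) (fun d => g t d ^ 2) ≤ 1 := by
      intro t
      refine expect_le (hk _) fun d => ?_
      have hm0 : 0 ≤ expect (k (c t)) (X t) := expect_nonneg (hk _) fun _ => ind_nonneg _
      have hm1 : expect (k (c t)) (X t) ≤ 1 := expect_le (hk _) fun _ => ind_le_one _
      have hx0 : 0 ≤ X t d := ind_nonneg _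
      have hx1 : X t d ≤ 1 := ind_le_one _
      rw [← sq_abs]
      have : |g t d| ≤ 1 := by
        simp only [hg]; rw [abs_le]; constructor <;> linarith
      exact pow_le_one₀ (abs_nonneg _) this
    have hpt : ∀ d : Fin n → D,
        ind (¬ |(∑ i, ind ((c i, d i) = (c₀, d₀))) / n - q (c₀, d₀)| ≤ ε * q (c₀, d₀)) ≤
        (1 / (n * η) ^ 2) * (∑ t, g t (d t)) ^ 2 := by
      intro d
      by_cases hbad : |(∑ i, ind ((c i, d i) = (c₀, d₀))) / n - q (c₀, d₀)| ≤ ε * q (c₀, d₀)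
      · rw [ind_false (not_not.2 hbad)]; positivity
      · rw [ind_true hbad]
        push Not at hbad
        have hs : (∑ t, g t (d t)) / n =
            ((∑ i, ind ((c i, d i) = (c₀, d₀))) / n - q (c₀, d₀)) -
              ((∑ t, expect (k (c t)) (X t)) / n - q (c₀, d₀)) := by
          simp only [hg, Finset.sum_sub_distrib, hX]; ring
        have hη2 : η ≤ |(∑ t, g t (d t)) / n| := by
          rw [hs]
          refine le_trans ?_ (abs_sub_abs_le_abs_sub _ _)
          rw [hηdef]; linarith
        have h3 : n * η ≤ |∑ t, g t (d t)| := by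
          rw [abs_div, abs_of_pos hn', le_div_iff₀ hn'] at hη2
          linarith
        have h4 : (n * η) ^ 2 ≤ (∑ t, g t (d t)) ^ 2 := by
          rw [← sq_abs (∑ t, g t (d t))]
          exact pow_le_pow_left₀ (by positivity) h3 2
        rw [one_div, inv_mul_eq_div, le_div_iff₀ (by positivity), one_mul]
        exact h4
    refine (expect_mono hpi hpt).trans ?_
    rw [expect_const_mul, expect_pi_sq_sum (fun t => hk (c t)) g hg0]
    calc 1 / (n * η) ^ 2 * ∑ t, expect (k (c t)) (fun d => g t d ^ 2)
        ≤ 1 / (n * η) ^ 2 * ∑ _t : Fin n, (1 : ℝ) := by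
          refine mul_le_mul_of_nonneg_left (Finset.sum_le_sum fun t _ => hg1 t) (by positivity)
      _ = 1 / η ^ 2 / n := by
          simp only [Finset.sum_const, Finset.card_univ, Fintype.card_fin, nsmul_eq_mul, mul_one]
          field_simp
  -- For a pair of mass 0 no deviation is tolerated and Chebyshev is useless. But the mean number of
  -- occurrences is then 0, so the pair almost surely does not occur.
  · have hsum0 : ∑ t, expect (k (c t)) (X t) = 0 := by
      rw [← h0, sub_zero, mul_zero] at hmeansum
      have := abs_eq_zero.1 (le_antisymm hmeansum (abs_nonneg _))
      rcases div_eq_zero_iff.1 this with h | h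
      · exact h
      · exact absurd h hn'.ne'
    have hpt : ∀ d : Fin n → D,
        ind (¬ |(∑ i, ind ((c i, d i) = (c₀, d₀))) / n - q (c₀, d₀)| ≤ ε * q (c₀, d₀)) ≤
        ∑ t, X t (d t) := by
      intro d
      by_cases hz : ∃ i, (c i, d i) = (c₀, d₀)
      · obtain ⟨i, hi⟩ := hz
        refine (ind_le_one _).trans ?_
        rw [← ind_true hi]
        exact Finset.single_le_sum (f := fun t => X t (d t)) (fun j _ => ind_nonneg _)
          (Finset.mem_univ i)
      · push Not at hz
        rw [ind_false]
        · exact Finset.sum_nonneg fun _ _ => ind_nonneg _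
        · have hz' : ∀ i, ind ((c i, d i) = (c₀, d₀)) = 0 := fun i => ind_false (hz i)
          simp only [hz', ← h0]
          simp
    refine (expect_mono hpi hpt).trans ?_
    rw [expect_sum]
    have : ∀ t, expect (piPmf fun t => k (c t)) (fun d => X t (d t)) = expect (k (c t)) (X t) :=
      fun t => expect_pi_eval (fun t => hk (c t)) t (X t)
    simp only [this, hsum0]
    positivity

/-- The weak law of large numbers for typical sequences. -/
lemma expect_iid_not_typical_le {q : D → ℝ} (hq : q ∈ stdSimplex ℝ D) {ε : ℝ} (hε : 0 < ε)
    (hn : 0 < n) :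
    expect (piPmf fun _ : Fin n => q) (fun d => ind (¬ Typical ε q d)) ≤
      chebyshevConst q ε / n := by
  -- The unconditional case is the conditional one over a one-point input alphabet, where the
  -- constant sequence is 0-typical.
  have hU : (fun _ : Unit => (1 : ℝ)) ∈ stdSimplex ℝ Unit := by
    constructor <;> simp
  have hc : Typical 0 (fun _ : Unit => (1 : ℝ)) (fun _ : Fin n => ()) := by
    rw [typical_iff]
    intro a
    have : (n : ℝ) ≠ 0 := Nat.cast_ne_zero.2 hn.ne'
    simp [ind, this]
  have h := expect_not_typical_le (k := fun _ : Unit => q) hU (fun _ => hq) hε hn hc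
  have hK : chebyshevConst (compProd (fun _ : Unit => (1 : ℝ)) fun _ => q) (ε - 0) =
      chebyshevConst q ε := by
    simp [chebyshevConst, Fintype.sum_prod_type, compProd]
  rw [hK] at h
  have hl : law (compProd (fun _ : Unit => (1 : ℝ)) fun _ => q) Prod.snd = q := by
    funext a
    rw [law_eq_expect, expect_compProd]
    refine (expect_const hU (expect q fun b => ind (b = a))).trans ?_
    have h2 := law_equiv q (Equiv.refl D) a
    rw [law_eq_expect] at h2
    simpa using h2
  refine le_trans (expect_mono (piPmf_mem fun _ => hq) fun d => ind_mono ?_) h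
  intro hd hd'
  have := hd'.map Prod.snd
  rw [hl] at this
  exact hd this

/-! ### Information density, packing and covering -/

/-- The information density of two random variables. -/
def infoDens (q : C → ℝ) (f : C → A) (g : C → B) (c : C) : ℝ :=
  Real.logb 2 (law q (fun c => (f c, g c)) (f c, g c) / (law q f (f c) * law q g (g c)))

/-- The expected absolute value of the information density. -/
def absInfo (q : C → ℝ) (f : C → A) (g : C → B) : ℝ := expect q fun c => |infoDens q f g c|

lemma mutualInfo_eq_expect (q : C → ℝ) (f : C → A) (g : C → B) :
    mutualInfo q f g = expect q (infoDens q f g) := by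
  unfold infoDens
  rw [← expect_law q (fun c => (f c, g c)) (fun ab => Real.logb 2
    (law q (fun c => (f c, g c)) ab / (law q f ab.1 * law q g ab.2)))]
  simp only [mutualInfo, expect, Fintype.sum_prod_type]

lemma law_swap (q : C → ℝ) (f : C → A) (g : C → B) (a : A) (b : B) :
    law q (fun c => (f c, g c)) (a, b) = law q (fun c => (g c, f c)) (b, a) := by
  unfold law
  exact Finset.sum_congr rfl fun c _ => by
    by_cases h1 : f c = a <;> by_cases h2 : g c = b <;> simp [h1, h2]

lemma infoDens_comm (q : C → ℝ) (f : C → A) (g : C → B) : infoDens q f g = infoDens q g f := by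
  funext c
  unfold infoDens
  rw [law_swap, mul_comm]

lemma mutualInfo_comm (q : C → ℝ) (f : C → A) (g : C → B) :
    mutualInfo q f g = mutualInfo q g f := by
  rw [mutualInfo_eq_expect, mutualInfo_eq_expect, infoDens_comm]

/-- On typical sequences, the two densities differ by a factor of about `2 ^ (n I)`. -/
lemma Typical.prod_law_eq {ε : ℝ} {q : C → ℝ} {c : Fin n → C} (h : Typical ε q c)
    (hq : q ∈ stdSimplex ℝ C) (f : C → A) (g : C → B) :
    ∏ t, law q f (f (c t)) =
      (∏ t, law q (fun c => (f c, g c)) (f (c t), g (c t)) / law q g (g (c t))) *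
        (2 : ℝ) ^ (-∑ t, infoDens q f g (c t)) := by
  rw [← Finset.sum_neg_distrib, Real.rpow_sum_of_pos two_pos, ← Finset.prod_mul_distrib]
  refine Finset.prod_congr rfl fun t _ => ?_
  have h0 := h.pos hq t
  have h1 : 0 < law q (fun c => (f c, g c)) (f (c t), g (c t)) :=
    h0.trans_le (le_law hq (fun c => (f c, g c)) (c t))
  have h2 := h0.trans_le (le_law hq f (c t))
  have h3 := h0.trans_le (le_law hq g (c t))
  rw [infoDens, Real.rpow_neg two_pos.le, Real.rpow_logb two_pos (by norm_num) (by positivity)]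
  field_simp

lemma Typical.abs_sum_infoDens {ε : ℝ} {q : C → ℝ} {c : Fin n → C} (h : Typical ε q c)
    (f : C → A) (g : C → B) :
    |∑ t, infoDens q f g (c t) - n * mutualInfo q f g| ≤ n * (ε * absInfo q f g) := by
  rw [mutualInfo_eq_expect]
  exact h.abs_sum_sub_le _

lemma sum_law_pair (q : C → ℝ) (f : C → A) (g : C → B) (b : B) :
    ∑ a, law q (fun c => (f c, g c)) (a, b) = law q g b := by
  classical
  unfold law
  rw [Finset.sum_comm]
  refine Finset.sum_congr rfl fun c _ => ?_
  rw [Finset.sum_eq_single (f c)]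
  · simp
  · intro a _ ha; simp [Ne.symm ha]
  · simp

/-- The packing lemma: an independent codeword is jointly typical with a given sequence with
probability at most `2 ^ (-n (I - δ))`. -/
lemma packing {q : C → ℝ} (hq : q ∈ stdSimplex ℝ C) (f : C → A) (g : C → B) {mk : A → B → C}
    (hf : ∀ a b, f (mk a b) = a) (hg : ∀ a b, g (mk a b) = b) (ε : ℝ) (b : Fin n → B) :
    expect (piPmf fun _ : Fin n => law q f)
      (fun a => ind (Typical ε q (fun t => mk (a t) (b t)))) ≤
      (2 : ℝ) ^ (-(n * (mutualInfo q f g - ε * absInfo q f g))) := by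
  -- The conditional mass function of `a` given `b`. Where `b` has mass 0 the quotient is 0, so the
  -- total is at most 1, which suffices.
  set r : A → B → ℝ := fun a b => law q (fun c => (f c, g c)) (a, b) / law q g b with hr
  have hr0 : ∀ a b, 0 ≤ r a b := fun a b => div_nonneg (law_nonneg hq _ _) (law_nonneg hq _ _)
  have hr1 : ∀ b, ∑ a, r a b ≤ 1 := by
    intro b
    rw [hr, ← Finset.sum_div, sum_law_pair]
    exact div_self_le_one _
  have hterm : ∀ a : Fin n → A, piPmf (fun _ : Fin n => law q f) a *
      ind (Typical ε q (fun t => mk (a t) (b t))) ≤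
      (∏ t, r (a t) (b t)) * (2 : ℝ) ^ (-(n * (mutualInfo q f g - ε * absInfo q f g))) := by
    intro a
    by_cases h : Typical ε q (fun t => mk (a t) (b t))
    · rw [ind_true h, mul_one]
      have h1 := h.prod_law_eq hq f g
      simp only [hf, hg] at h1
      rw [piPmf, h1]
      refine mul_le_mul_of_nonneg_left ?_ (Finset.prod_nonneg fun t _ => hr0 _ _)
      refine Real.rpow_le_rpow_of_exponent_le one_le_two ?_
      have h2 := (abs_le.1 (h.abs_sum_infoDens f g)).1
      linarith
    · rw [ind_false h, mul_zero]
      exact mul_nonneg (Finset.prod_nonneg fun t _ => hr0 _ _) (by positivity)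
  refine (Finset.sum_le_sum fun a _ => hterm a).trans ?_
  rw [← Finset.sum_mul]
  refine mul_le_of_le_one_left (by positivity) ?_
  have := Finset.prod_univ_sum (fun _ : Fin n => (Finset.univ : Finset A))
    (fun t a => r a (b t))
  rw [Fintype.piFinset_univ] at this
  rw [← this]
  exact Finset.prod_le_one (fun t _ => Finset.sum_nonneg fun a _ => hr0 _ _) fun t _ => hr1 _

/-- The covering bound: a codeword drawn from the output distribution of the test channel `k` is
jointly typical with a typical sequence with probability at least `2 ^ (-n (I + δ)) (1 - o(1))`. -/
lemma covering {p : A → ℝ} {k : A → B → ℝ} (hp : p ∈ stdSimplex ℝ A)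
    (hk : ∀ a, k a ∈ stdSimplex ℝ B) {ε' ε : ℝ} (hε : ε' < ε) (hn : 0 < n)
    {y : Fin n → A} (hy : Typical ε' p y) :
    (2 : ℝ) ^ (-(n * (mutualInfo (compProd p k) Prod.snd Prod.fst +
        ε * absInfo (compProd p k) Prod.snd Prod.fst))) *
      (1 - chebyshevConst (compProd p k) (ε - ε') / n) ≤
    expect (piPmf fun _ : Fin n => law (compProd p k) Prod.snd)
      (fun v => ind (Typical ε (compProd p k) (fun t => (y t, v t)))) := by
  set q := compProd p k with hq
  have hqm : q ∈ stdSimplex ℝ (A × B) := compProd_mem hp hk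
  have h1 : 1 - chebyshevConst q (ε - ε') / n ≤
      expect (piPmf fun t => k (y t)) (fun v => ind (Typical ε q (fun t => (y t, v t)))) := by
    have h := expect_not_typical_le hp hk hε hn hy
    simp only [ind_not] at h
    rw [expect_sub, expect_const (piPmf_mem fun t => hk (y t))] at h
    linarith
  refine (mul_le_mul_of_nonneg_left h1 (by positivity)).trans ?_
  rw [expect, expect, Finset.mul_sum]
  refine Finset.sum_le_sum fun v _ => ?_
  by_cases h : Typical ε q (fun t => (y t, v t))
  · rw [ind_true h, mul_one, mul_one]
    have h2 := h.prod_law_eq hqm Prod.snd Prod.fst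
    dsimp only at h2
    unfold piPmf
    rw [h2, mul_comm]
    -- The conditional density in `Typical.prod_law_eq` is the test channel itself. A memoryless
    -- codeword thus has at least 2^(-n(I+δ)) times the probability that the test channel gives it.
    have h3 : ∀ t, law q (fun c => (c.2, c.1)) (v t, y t) / law q Prod.fst (y t) =
        k (y t) (v t) := by
      intro t
      have h4 : law q (fun c => (c.2, c.1)) (v t, y t) = q (y t, v t) :=
        law_equiv q (Equiv.prodComm A B) (v t, y t)
      have h5 := h.pos hqm t
      rw [h4, hq, law_compProd_fst _ hk]
      have h6 : p (y t) ≠ 0 := by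
        intro h0
        simp [hq, compProd, h0] at h5
      simp only [compProd]
      field_simp
    simp only [h3]
    refine mul_le_mul_of_nonneg_left ?_ (Finset.prod_nonneg fun t _ => (hk _).1 _)
    refine Real.rpow_le_rpow_of_exponent_le one_le_two ?_
    have h7 := (abs_le.1 (h.abs_sum_infoDens Prod.snd Prod.fst)).2
    linarith
  · rw [ind_false h, mul_zero, mul_zero, mul_zero]

end typical

end

section

/-! ### The first index with a given property -/

section first

variable {J A : Type*} [Fintype J] [DecidableEq J] [Fintype A] {N : ℕ}

/-- `u` is the first index, in the order given by `e`, with the property `T`. -/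
def IsFirst (e : J ≃ Fin N) (T : J → Prop) (u : J) : Prop := T u ∧ ∀ v, e v < e u → ¬ T v

/-- The index stands outside the implication so that choosing it gives a total quantizer, with an
arbitrary value when nothing fits. -/
lemma exists_isFirst [Nonempty J] (e : J ≃ Fin N) (T : J → Prop) :
    ∃ u, (∃ v, T v) → IsFirst e T u := by
  by_cases h : ∃ v, T v
  · obtain ⟨u, hu, hmin⟩ := (measure fun v => (e v : ℕ)).wf.has_min {v | T v} h
    exact ⟨u, fun _ => ⟨hu, fun v hv hT => hmin v hT hv⟩⟩
  · exact ⟨Classical.arbitrary J, fun h' => absurd h' h⟩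

/-- A geometric series with one repeated term: by truncated subtraction both `k = 0` and `k = 1`
contribute `q`. Hence the bound 2 instead of 1. -/
lemma sum_mul_one_sub_pow_le {q : ℝ} (hq1 : q ≤ 1) (N : ℕ) :
    ∑ k : Fin N, q * (1 - q) ^ ((k : ℕ) - 1) ≤ 2 := by
  rw [Fin.sum_univ_eq_sum_range (fun k => q * (1 - q) ^ (k - 1))]
  rcases N with _ | N
  · simp
  · have h : ∀ N : ℕ, ∑ k ∈ Finset.range (N + 1), q * (1 - q) ^ (k - 1) =
        q + 1 - (1 - q) ^ N := by
      intro N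
      induction N with
      | zero => simp
      | succ N ih => rw [Finset.sum_range_succ, ih, Nat.add_sub_cancel, pow_succ]; ring
    rw [h]
    have : 0 ≤ (1 - q) ^ N := pow_nonneg (by linarith) _
    linarith

/-- The event is a product of conditions on distinct independent codewords: success at `u`, `V` at
`u'`, failure before `u`. If `u'` precedes `u`, its own failure is dropped to make room for `V`, so
one factor may be missing from the power. -/
lemma expect_isFirst_and_le {p : A → ℝ} (hp : p ∈ stdSimplex ℝ A) (e : J ≃ Fin N)
    (T V : A → Prop) {u u' : J} (hu : u' ≠ u) :
    expect (piPmf fun _ : J => p) (fun x => ind (IsFirst e (fun v => T (x v)) u ∧ V (x u'))) ≤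
      expect p (fun a => ind (T a)) * (1 - expect p (fun a => ind (T a))) ^ ((e u : ℕ) - 1) *
        expect p (fun a => ind (V a)) := by
  classical
  set q := expect p (fun a => ind (T a)) with hq
  have hq0 : 0 ≤ q := expect_nonneg hp fun _ => ind_nonneg _
  have hq1 : q ≤ 1 := expect_le hp fun _ => ind_le_one _
  have hV0 : 0 ≤ expect p (fun a => ind (V a)) := expect_nonneg hp fun _ => ind_nonneg _
  set φ : J → A → ℝ := fun i a => if i = u then ind (T a) else if i = u' then ind (V a) else
    if e i < e u then ind (¬ T a) else 1 with hφ
  have h1 : ∀ x : J → A, ind (IsFirst e (fun v => T (x v)) u ∧ V (x u')) ≤ ∏ i, φ i (x i) := by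
    intro x
    by_cases h : IsFirst e (fun v => T (x v)) u ∧ V (x u')
    · rw [ind_true h, Finset.prod_eq_one]
      intro i _
      simp only [hφ]
      split_ifs with h1 h2 h3
      · rw [h1]; exact ind_true h.1.1
      · rw [h2]; exact ind_true h.2
      · exact ind_true (h.1.2 i h3)
      · rfl
    · rw [ind_false h]
      refine Finset.prod_nonneg fun i _ => ?_
      simp only [hφ]
      split_ifs
      · exact ind_nonneg _
      · exact ind_nonneg _
      · exact ind_nonneg _
      · exact zero_le_one
  refine (expect_mono (piPmf_mem fun _ => hp) h1).trans ?_
  rw [expect_pi_prod, ← Finset.mul_prod_erase _ _ (Finset.mem_univ u),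
    ← Finset.mul_prod_erase _ _ (Finset.mem_erase.2 ⟨hu, Finset.mem_univ u'⟩)]
  have hφu : expect p (φ u) = q := by simp [hφ, hq]
  have hφu' : expect p (φ u') = expect p (fun a => ind (V a)) := by simp [hφ, hu]
  have hrest : ∏ i ∈ (Finset.univ.erase u).erase u', expect p (φ i) =
      (1 - q) ^ (((Finset.univ.erase u).erase u').filter fun i => e i < e u).card := by
    rw [← Finset.prod_const, Finset.prod_filter]
    refine Finset.prod_congr rfl fun i hi => ?_
    rw [Finset.mem_erase, Finset.mem_erase] at hi
    simp only [hφ, hi.1, hi.2.1, if_false]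
    split_ifs
    · simp only [ind_not]; rw [expect_sub, expect_const hp]
    · exact expect_const hp 1
  -- At most one of the indices before `u`, namely `u'`, has been removed.
  have hcard : (e u : ℕ) - 1 ≤
      (((Finset.univ.erase u).erase u').filter fun i => e i < e u).card := by
    have h2 : (Finset.univ.filter fun i => e i < e u).card = (e u : ℕ) := by
      rw [← Fin.card_Iio (e u)]
      refine Finset.card_bij (fun i _ => e i) ?_ ?_ ?_
      · intro i hi; simpa using hi
      · intro i _ j _ h; exact e.injective h
      · intro k hk; exact ⟨e.symm k, by simpa using hk, by simp⟩
    have h3 : (Finset.univ.filter fun i => e i < e u).erase u' ⊆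
        ((Finset.univ.erase u).erase u').filter fun i => e i < e u := by
      intro i hi
      simp only [Finset.mem_erase, Finset.mem_filter, Finset.mem_univ, true_and, and_true] at hi ⊢
      refine ⟨⟨hi.1, ?_⟩, hi.2⟩
      rintro rfl
      exact lt_irrefl _ hi.2
    calc (e u : ℕ) - 1 ≤ ((Finset.univ.filter fun i => e i < e u).erase u').card := by
          rw [← h2]; exact Finset.pred_card_le_card_erase
      _ ≤ _ := Finset.card_le_card h3
  rw [hφu, hφu', hrest]
  calc q * (expect p (fun a => ind (V a)) * _)
      ≤ q * (expect p (fun a => ind (V a)) * (1 - q) ^ ((e u : ℕ) - 1)) := by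
        refine mul_le_mul_of_nonneg_left (mul_le_mul_of_nonneg_left ?_ hV0) hq0
        exact pow_le_pow_of_le_one (by linarith) (by linarith) hcard
    _ = _ := by ring

/-- A wrong index in the bin of the first index with the property `T` has the property `V` with
probability at most `2 (B - 1) P(V)`. -/
lemma expect_bin_collision_le {S B : ℕ} {p : A → ℝ} (hp : p ∈ stdSimplex ℝ A)
    (e : Fin S × Fin B ≃ Fin N) (hB : 0 < B) (T V : A → Prop) {r : ℝ}
    (hr : expect p (fun a => ind (V a)) ≤ r) :
    expect (piPmf fun _ : Fin S × Fin B => p) (fun x => ind (∃ u u', u' ≠ u ∧ u'.1 = u.1 ∧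
      IsFirst e (fun v => T (x v)) u ∧ V (x u'))) ≤ 2 * ((B : ℝ) - 1) * r := by
  classical
  set q := expect p (fun a => ind (T a)) with hq
  have hq0 : 0 ≤ q := expect_nonneg hp fun _ => ind_nonneg _
  have hq1 : q ≤ 1 := expect_le hp fun _ => ind_le_one _
  have hr0 : 0 ≤ r := (expect_nonneg hp fun _ => ind_nonneg _).trans hr
  set nb : Fin S × Fin B → Finset (Fin S × Fin B) := fun u =>
    Finset.univ.filter fun u' => u' ≠ u ∧ u'.1 = u.1 with hnb
  have hcard : ∀ u, ((nb u).card : ℝ) = (B : ℝ) - 1 := by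
    intro u
    have : nb u = ((Finset.univ : Finset (Fin B)).erase u.2).image fun b => (u.1, b) := by
      ext ⟨s, b⟩
      obtain ⟨s', b'⟩ := u
      simp only [hnb, Finset.mem_filter, Finset.mem_univ, true_and, Finset.mem_image,
        Finset.mem_erase, and_true, Prod.mk.injEq, ne_eq]
      constructor
      · rintro ⟨h1, rfl⟩
        exact ⟨b, fun h => h1 ⟨rfl, h⟩, rfl, rfl⟩
      · rintro ⟨b'', h1, rfl, rfl⟩
        exact ⟨fun h => h1 h.2, rfl⟩
    rw [this, Finset.card_image_of_injective _ (fun a b h => (Prod.mk.inj h).2),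
      Finset.card_erase_of_mem (Finset.mem_univ _), Finset.card_univ, Fintype.card_fin,
      Nat.cast_sub hB, Nat.cast_one]
  have h1 : ∀ x : Fin S × Fin B → A, ind (∃ u u', u' ≠ u ∧ u'.1 = u.1 ∧
      IsFirst e (fun v => T (x v)) u ∧ V (x u')) ≤
      ∑ u, ∑ u' ∈ nb u, ind (IsFirst e (fun v => T (x v)) u ∧ V (x u')) := by
    intro x
    refine le_trans ?_ (Finset.sum_le_sum fun u _ => ind_exists_le (nb u) _)
    refine le_trans (ind_mono ?_) (ind_exists_le Finset.univ _)
    rintro ⟨u, u', h1, h2, h3⟩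
    exact ⟨u, Finset.mem_univ _, u', by simp [hnb, h1, h2], h3⟩
  refine (expect_mono (piPmf_mem fun _ => hp) h1).trans ?_
  simp only [expect_sum]
  calc _ ≤ ∑ u : Fin S × Fin B, ∑ u' ∈ nb u, q * (1 - q) ^ ((e u : ℕ) - 1) * r := by
        refine Finset.sum_le_sum fun u _ => Finset.sum_le_sum fun u' hu' => ?_
        have hne : u' ≠ u := (Finset.mem_filter.1 hu').2.1
        refine (expect_isFirst_and_le hp e T V hne).trans ?_
        exact mul_le_mul_of_nonneg_left hr
          (mul_nonneg hq0 (pow_nonneg (by linarith) _))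
    _ = ((B : ℝ) - 1) * r * ∑ u : Fin S × Fin B, q * (1 - q) ^ ((e u : ℕ) - 1) := by
        simp only [Finset.sum_const, nsmul_eq_mul, hcard, Finset.mul_sum]
        exact Finset.sum_congr rfl fun _ _ => by ring
    _ ≤ ((B : ℝ) - 1) * r * 2 := by
        have hB1 : (1 : ℝ) ≤ B := by exact_mod_cast hB
        refine mul_le_mul_of_nonneg_left ?_ (mul_nonneg (by linarith) hr0)
        -- Summed over the possible first indices, the weights are bounded independently of `q` and
        -- of the number of indices.
        rw [Equiv.sum_comp e (fun k : Fin N => q * (1 - q) ^ ((k : ℕ) - 1))]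
        exact sum_mul_one_sub_pow_le hq1 N
    _ = _ := by ring

/-- Independent trials all fail with probability at most (1 - q)^|J|, and 1 - q ≤ exp(-q). Covering
succeeds once q|J| tends to infinity. -/
lemma expect_forall_not_le {p : A → ℝ} (hp : p ∈ stdSimplex ℝ A) (T : A → Prop) {q : ℝ}
    (hq : q ≤ expect p (fun a => ind (T a))) :
    expect (piPmf fun _ : J => p) (fun x => ind (∀ u, ¬ T (x u))) ≤
      Real.exp (-(q * Fintype.card J)) := by
  have h1 : ∀ x : J → A, ind (∀ u, ¬ T (x u)) ≤ ∏ u, ind (¬ T (x u)) := by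
    intro x
    by_cases h : ∀ u, ¬ T (x u)
    · rw [ind_true h, Finset.prod_eq_one fun u _ => ind_true (h u)]
    · rw [ind_false h]; exact Finset.prod_nonneg fun _ _ => ind_nonneg _
  refine (expect_mono (piPmf_mem fun _ => hp) h1).trans ?_
  rw [expect_pi_prod (fun _ : J => p) (fun _ a => ind (¬ T a))]
  simp only [ind_not]
  rw [expect_sub, expect_const hp, Finset.prod_const, Finset.card_univ]
  have hle : expect p (fun a => ind (T a)) ≤ 1 := expect_le hp fun _ => ind_le_one _
  calc _ ≤ (Real.exp (-q)) ^ Fintype.card J := by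
        refine pow_le_pow_left₀ (by linarith) ?_ _
        have := Real.add_one_le_exp (-q)
        linarith
    _ = _ := by rw [← Real.exp_nat_mul]; congr 1; ring

end first

end

section

lemma theUnique_eq_some {α : Type*} {Q : α → Prop} {a : α} (ha : Q a) (h : ∀ b, Q b → b = a) :
    theUnique Q = some a := by
  have hu : ∃! a, Q a := ⟨a, ha, h⟩
  unfold theUnique
  rw [dif_pos hu, h _ hu.choose_spec.1]

variable {X11 X21 X12 X22 XR YR Y11 Y12 Yh : Type*}
  [Fintype X11] [Fintype X21] [Fintype X12] [Fintype X22] [Fintype XR]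
  [Fintype YR] [Fintype Y11] [Fintype Y12] [Fintype Yh]
  (W : Channel X11 X21 X12 X22 XR YR Y11 Y12) (P : InputDist X11 X21 X12 X22 XR YR Yh)

/-! ### The typicality tests of the scheme -/

/-- Joint typicality of `(y_R, ŷ_R)`. -/
def TypQuant (ε : ℝ) {n : ℕ} (yR : Fin n → YR) (yh : Fin n → Yh) : Prop :=
  Typical ε (law (joint1 W P) fun (_, _, yR, _, yh) => (yR, yh)) fun t => (yR t, yh t)

/-- Joint typicality of `(y₁₁, ŷ_R)`. -/
def TypDest (ε : ℝ) {n : ℕ} (y : Fin n → Y11) (yh : Fin n → Yh) : Prop :=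
  Typical ε (law (joint1 W P) fun (_, _, _, y, yh) => (y, yh)) fun t => (y t, yh t)

/-- Joint typicality of `(x₁₁, x₂₁, y₁₁, ŷ_R)`. -/
def TypSlot1 (ε : ℝ) {n : ℕ} (x₁ : Fin n → X11) (x₂ : Fin n → X21) (y : Fin n → Y11)
    (yh : Fin n → Yh) : Prop :=
  Typical ε (law (joint1 W P) fun (x₁, x₂, _, y, yh) => (x₁, x₂, y, yh))
    fun t => (x₁ t, x₂ t, y t, yh t)

/-- Joint typicality of `(x_R, y₁₂)`. -/
def TypBin (ε : ℝ) {m : ℕ} (xR : Fin m → XR) (y : Fin m → Y12) : Prop :=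
  Typical ε (law (joint2 W P) fun (_, _, xR, y) => (xR, y)) fun t => (xR t, y t)

/-- Joint typicality of `(x₁₂, x₂₂, x_R, y₁₂)`. -/
def TypSlot2 (ε : ℝ) {m : ℕ} (x₁ : Fin m → X12) (x₂ : Fin m → X22) (xR : Fin m → XR)
    (y : Fin m → Y12) : Prop :=
  Typical ε (law (joint2 W P) fun (x₁, x₂, xR, y) => (x₁, x₂, xR, y))
    fun t => (x₁ t, x₂ t, xR t, y t)

variable {W P}

/-- With this, the correct quantization index passes its test as soon as the full slot 1 tuple is
typical; no further bad event is needed. -/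
lemma TypSlot1.typDest {ε : ℝ} {n : ℕ} {x₁ : Fin n → X11} {x₂ : Fin n → X21} {y : Fin n → Y11}
    {yh : Fin n → Yh} (h : TypSlot1 W P ε x₁ x₂ y yh) : TypDest W P ε y yh := by
  have := Typical.map h (fun a => (a.2.2.1, a.2.2.2))
  rw [law_law] at this
  exact this

lemma TypSlot2.typBin {ε : ℝ} {m : ℕ} {x₁ : Fin m → X12} {x₂ : Fin m → X22} {xR : Fin m → XR}
    {y : Fin m → Y12} (h : TypSlot2 W P ε x₁ x₂ xR y) : TypBin W P ε xR y := by
  have := Typical.map h (fun a => (a.2.2.1, a.2.2.2))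
  rw [law_law] at this
  exact this

/-- The destination decodes correctly if the true sequences are typical and no wrong ones are. -/
lemma CFScheme.dec_eq {ε' ε : ℝ} {n m M₁ M₂ S B : ℕ} [NeZero M₁] [NeZero M₂]
    (c : CFScheme W P ε' n m M₁ M₂ S B) {w₁ : Fin M₁} {w₂ : Fin M₂} {u : Fin S × Fin B}
    {y1 : Fin n → Y11} {y2 : Fin m → Y12}
    (h1 : TypSlot1 W P ε (c.x11 w₁) (c.x21 w₂) y1 (c.yhat u))
    (h2 : TypSlot2 W P ε (c.x12 w₁) (c.x22 w₂) (c.xR u.1) y2)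
    (hs : ∀ s, s ≠ u.1 → ¬ TypBin W P ε (c.xR s) y2)
    (hu : ∀ u', u' ≠ u → u'.1 = u.1 → ¬ TypDest W P ε y1 (c.yhat u'))
    (hw : ∀ w, w ≠ (w₁, w₂) → ¬ (TypSlot1 W P ε (c.x11 w.1) (c.x21 w.2) y1 (c.yhat u) ∧
      TypSlot2 W P ε (c.x12 w.1) (c.x22 w.2) (c.xR u.1) y2)) :
    (c.toCode ε).dec y1 y2 = (w₁, w₂) := by
  have e1 : c.decBin ε y2 = some u.1 :=
    theUnique_eq_some h2.typBin fun s hs' => by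
      by_contra hne
      exact hs s hne hs'
  have e2 : c.decQuant ε y1 u.1 = some u :=
    theUnique_eq_some ⟨rfl, h1.typDest⟩ fun u' hu' => by
      by_contra hne
      exact hu u' hne hu'.1 hu'.2
  have e3 : c.decMsg ε y1 y2 u.1 u = some (w₁, w₂) :=
    theUnique_eq_some ⟨h1, h2⟩ fun w hw' => by
      by_contra hne
      exact hw w hne hw'
  simp only [CFScheme.toCode, e1, e2, e3, Option.bind_some, Option.getD_some]

/-! ### The one-letter laws -/

lemma law_apply_injective {Ω A : Type*} [Fintype Ω] (p : Ω → ℝ) {f : Ω → A}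
    (hf : Function.Injective f) (ω : Ω) : law p f (f ω) = p ω := by
  classical
  unfold law
  rw [Finset.sum_eq_single ω]
  · simp
  · intro b _ hb; rw [if_neg fun h => hb (hf h)]
  · simp

lemma expect_ind_eq {Ω : Type*} [Fintype Ω] (p : Ω → ℝ) (a : Ω) :
    expect p (fun ω => ind (ω = a)) = p a :=
  (law_eq_expect p id a).symm.trans (law_apply_injective p Function.injective_id a)

variable (W P)

/-- The joint law of the channel inputs and outputs in slot 1. -/
def chan1 : X11 × X21 × YR × Y11 → ℝ :=
  compProd P.p11 fun x₁ => compProd P.p21 fun x₂ => W.slot1 x₁ x₂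

lemma chan1_mem : chan1 W P ∈ stdSimplex ℝ _ :=
  compProd_mem P.p11_mem fun _ => compProd_mem P.p21_mem fun _ => W.slot1_mem _ _

/-- Exhibits the test channel as a last kernel that sees only `y_R`, that is, the Markov chain
behind the scheme. -/
lemma joint1_eq : joint1 W P = law (compProd (chan1 W P) fun ω => P.quant ω.2.2.1)
    (fun ω => (ω.1.1, ω.1.2.1, ω.1.2.2.1, ω.1.2.2.2, ω.2)) := by
  have hinj : Function.Injective (fun ω : (X11 × X21 × YR × Y11) × Yh =>
      (ω.1.1, ω.1.2.1, ω.1.2.2.1, ω.1.2.2.2, ω.2)) := by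
    rintro ⟨⟨a, b, c, d⟩, e⟩ ⟨⟨a', b', c', d'⟩, e'⟩ h
    simpa [and_assoc] using h
  funext ⟨x₁, x₂, yR, y, yh⟩
  refine Eq.trans ?_ (law_apply_injective _ hinj ((x₁, x₂, yR, y), yh)).symm
  simp only [joint1, compProd, chan1]
  ring

lemma expect_joint1 (F : X11 × X21 × YR × Y11 × Yh → ℝ) :
    expect (joint1 W P) F = expect (chan1 W P) (fun ω => expect (P.quant ω.2.2.1)
      (fun yh => F (ω.1, ω.2.1, ω.2.2.1, ω.2.2.2, yh))) := by
  rw [joint1_eq, expect_law, expect_compProd]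

lemma joint1_mem : joint1 W P ∈ stdSimplex ℝ _ := by
  rw [joint1_eq]
  exact law_mem (compProd_mem (chan1_mem W P) fun _ => P.quant_mem _) _

lemma joint2_eq : joint2 W P =
    compProd P.p12 fun x₁ => compProd P.p22 fun x₂ => compProd P.pR fun xR => W.slot2 x₁ x₂ xR := by
  funext ⟨x₁, x₂, xR, y⟩
  simp only [joint2, compProd]
  ring

lemma joint2_mem : joint2 W P ∈ stdSimplex ℝ _ := by
  rw [joint2_eq]
  exact compProd_mem P.p12_mem fun _ => compProd_mem P.p22_mem fun _ =>
    compProd_mem P.pR_mem fun _ => W.slot2_mem _ _ _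

lemma law_joint1_x1 : law (joint1 W P) (fun ω => ω.1) = P.p11 := by
  funext a
  rw [law_eq_expect, expect_joint1]
  simp only [expect_const (P.quant_mem _)]
  rw [chan1, expect_compProd]
  simp only [expect_const (compProd_mem P.p21_mem fun _ => W.slot1_mem _ _), expect_ind_eq]

lemma law_joint1_x12 : law (joint1 W P) (fun ω => (ω.1, ω.2.1)) =
    compProd P.p11 fun _ => P.p21 := by
  funext a
  rw [law_eq_expect, expect_joint1]
  simp only [expect_const (P.quant_mem _)]
  rw [chan1, expect_compProd, ← expect_ind_eq (compProd P.p11 fun _ => P.p21), expect_compProd]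
  simp only [expect_compProd, expect_const (W.slot1_mem _ _)]

lemma law_joint1_x2 : law (joint1 W P) (fun ω => ω.2.1) = P.p21 := by
  have := congrArg (fun p => law p Prod.snd) (law_joint1_x12 W P)
  simp only [law_law] at this
  rw [this]
  funext a
  rw [law_eq_expect, expect_compProd]
  simp only [expect_ind_eq, expect_const P.p11_mem]

lemma law_joint2_x1 : law (joint2 W P) (fun ω => ω.1) = P.p12 := by
  rw [joint2_eq]
  exact law_compProd_fst _ fun _ => compProd_mem P.p22_mem fun _ =>
    compProd_mem P.pR_mem fun _ => W.slot2_mem _ _ _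

lemma law_joint2_x12 : law (joint2 W P) (fun ω => (ω.1, ω.2.1)) =
    compProd P.p12 fun _ => P.p22 := by
  funext a
  rw [law_eq_expect, joint2_eq, expect_compProd,
    ← expect_ind_eq (compProd P.p12 fun _ => P.p22), expect_compProd]
  simp only [expect_compProd, expect_const (W.slot2_mem _ _ _), expect_const P.pR_mem]

lemma law_joint2_x2 : law (joint2 W P) (fun ω => ω.2.1) = P.p22 := by
  have := congrArg (fun p => law p Prod.snd) (law_joint2_x12 W P)
  simp only [law_law] at this
  rw [this]
  funext a
  rw [law_eq_expect, expect_compProd]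
  simp only [expect_ind_eq, expect_const P.p12_mem]

lemma law_joint2_xR : law (joint2 W P) (fun ω => ω.2.2.1) = P.pR := by
  funext a
  rw [law_eq_expect, joint2_eq]
  simp only [expect_compProd, expect_const (W.slot2_mem _ _ _), expect_ind_eq,
    expect_const P.p12_mem, expect_const P.p22_mem]

/-- The marginal law of `Y_R`. -/
def lawYR : YR → ℝ := law (chan1 W P) fun ω => ω.2.2.1

lemma lawYR_mem : lawYR W P ∈ stdSimplex ℝ YR := law_mem (chan1_mem W P) _

/-- The marginal law of `Ŷ_R`. -/
def lawYh : Yh → ℝ := law (joint1 W P) fun ω => ω.2.2.2.2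

lemma lawYh_mem : lawYh W P ∈ stdSimplex ℝ Yh := law_mem (joint1_mem W P) _

lemma law_joint1_quant : law (joint1 W P) (fun ω => (ω.2.2.1, ω.2.2.2.2)) =
    compProd (lawYR W P) P.quant := by
  funext a
  rw [law_eq_expect, expect_joint1, ← expect_ind_eq (compProd (lawYR W P) P.quant),
    expect_compProd, lawYR, expect_law]

lemma typQuant_iff {ε : ℝ} {n : ℕ} {yR : Fin n → YR} {yh : Fin n → Yh} :
    TypQuant W P ε yR yh ↔ Typical ε (compProd (lawYR W P) P.quant) fun t => (yR t, yh t) := by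
  rw [← law_joint1_quant]; rfl

lemma law_quant_snd : law (compProd (lawYR W P) P.quant) Prod.snd = lawYh W P := by
  rw [← law_joint1_quant, law_law]; rfl

/-- The joint law in slot 1 arises from `(Y_R, Ŷ_R)` by a kernel that depends on `Y_R` only. -/
lemma exists_kernel_chan1 : ∃ k : YR → X11 × X21 × Y11 → ℝ, (∀ y, k y ∈ stdSimplex ℝ _) ∧
    law (chan1 W P) (fun ω => (ω.2.2.1, (ω.1, ω.2.1, ω.2.2.2))) = compProd (lawYR W P) k ∧
    law (joint1 W P) (fun ω => ((ω.2.2.1, ω.2.2.2.2), (ω.1, ω.2.1, ω.2.2.2.1))) =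
      compProd (compProd (lawYR W P) P.quant) fun y => k y.1 := by
  obtain ⟨k, hk, hq⟩ := exists_kernel
    (law_mem (chan1_mem W P) fun ω => (ω.2.2.1, (ω.1, ω.2.1, ω.2.2.2)))
  rw [law_law] at hq
  refine ⟨k, hk, hq, ?_⟩
  funext a
  rw [law_eq_expect, expect_joint1,
    ← expect_ind_eq (compProd (compProd (lawYR W P) P.quant) fun y => k y.1), expect_compProd,
    expect_compProd]
  -- Given `y`, the test channel and `k` act independently, so their order may be exchanged.
  have h1 : ∀ y, expect (P.quant y) (fun b => expect (k y) fun c => ind (((y, b), c) = a)) =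
      expect (k y) (fun c => expect (P.quant y) fun b => ind (((y, b), c) = a)) :=
    fun y => expect_comm _ _ _
  simp only [h1]
  have h2 := expect_compProd (lawYR W P) k
    (fun yc => expect (P.quant yc.1) fun b => ind (((yc.1, b), yc.2) = a))
  refine Eq.trans ?_ h2
  rw [lawYR, ← hq, expect_law]

end

section

variable {X11 X21 X12 X22 XR YR Y11 Y12 Yh : Type*}
  [Fintype X11] [Fintype X21] [Fintype X12] [Fintype X22] [Fintype XR]
  [Fintype YR] [Fintype Y11] [Fintype Y12] [Fintype Yh]
  (W : Channel X11 X21 X12 X22 XR YR Y11 Y12) (P : InputDist X11 X21 X12 X22 XR YR Yh)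

/-! ### Packing bounds for the typicality tests -/

/-- The constant is quantified before `ε` and the block length, so that `ε` can later be chosen
small against it. The same holds for the bounds that follow. -/
lemma exists_packing_bin : ∃ κ : ℝ, ∀ (ε : ℝ) (m : ℕ) (y : Fin m → Y12),
    expect (piPmf fun _ : Fin m => P.pR) (fun x => ind (TypBin W P ε x y)) ≤
      (2 : ℝ) ^ (-(m * (infoRelayDest W P - ε * κ))) := by
  refine ⟨absInfo (law (joint2 W P) fun (_, _, xR, y) => (xR, y)) Prod.fst Prod.snd,
    fun ε m y => ?_⟩
  have h := packing (law_mem (joint2_mem W P) fun (_, _, xR, y) => (xR, y)) Prod.fst Prod.snd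
    (mk := Prod.mk) (fun _ _ => rfl) (fun _ _ => rfl) ε y
  rw [law_law, mutualInfo_law] at h
  rw [← law_joint2_xR W P]
  exact h

lemma exists_packing_dest : ∃ κ : ℝ, ∀ (ε : ℝ) (n : ℕ) (y : Fin n → Y11),
    expect (piPmf fun _ : Fin n => lawYh W P) (fun v => ind (TypDest W P ε y v)) ≤
      (2 : ℝ) ^ (-(n * (infoDestQuant W P - ε * κ))) := by
  refine ⟨absInfo (law (joint1 W P) fun (_, _, _, y, yh) => (y, yh)) Prod.snd Prod.fst,
    fun ε n y => ?_⟩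
  have h := packing (law_mem (joint1_mem W P) fun (_, _, _, y, yh) => (y, yh)) Prod.snd Prod.fst
    (mk := fun a b => (b, a)) (fun _ _ => rfl) (fun _ _ => rfl) ε y
  rw [law_law, mutualInfo_law, mutualInfo_comm] at h
  exact h

lemma exists_packing_slot1_left : ∃ κ : ℝ, ∀ (ε : ℝ) (n : ℕ) (x₂ : Fin n → X21) (y : Fin n → Y11)
    (v : Fin n → Yh),
    expect (piPmf fun _ : Fin n => P.p11) (fun x₁ => ind (TypSlot1 W P ε x₁ x₂ y v)) ≤
      (2 : ℝ) ^ (-(n * (mutualInfo (joint1 W P) (fun (x₁, _, _, _, _) => x₁)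
        (fun (_, x₂, _, y, yh) => (x₂, y, yh)) - ε * κ))) := by
  refine ⟨absInfo (law (joint1 W P) fun (x₁, x₂, _, y, yh) => (x₁, x₂, y, yh)) Prod.fst Prod.snd,
    fun ε n x₂ y v => ?_⟩
  have h := packing (law_mem (joint1_mem W P) fun (x₁, x₂, _, y, yh) => (x₁, x₂, y, yh))
    Prod.fst Prod.snd (mk := Prod.mk) (fun _ _ => rfl) (fun _ _ => rfl) ε
    (fun t => (x₂ t, y t, v t))
  rw [law_law, mutualInfo_law] at h
  rw [← law_joint1_x1 W P]
  exact h

lemma exists_packing_slot1_right : ∃ κ : ℝ, ∀ (ε : ℝ) (n : ℕ) (x₁ : Fin n → X11)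
    (y : Fin n → Y11) (v : Fin n → Yh),
    expect (piPmf fun _ : Fin n => P.p21) (fun x₂ => ind (TypSlot1 W P ε x₁ x₂ y v)) ≤
      (2 : ℝ) ^ (-(n * (mutualInfo (joint1 W P) (fun (_, x₂, _, _, _) => x₂)
        (fun (x₁, _, _, y, yh) => (x₁, y, yh)) - ε * κ))) := by
  refine ⟨absInfo (law (joint1 W P) fun (x₁, x₂, _, y, yh) => (x₁, x₂, y, yh))
    (fun c => c.2.1) (fun c => (c.1, c.2.2)), fun ε n x₁ y v => ?_⟩
  have h := packing (law_mem (joint1_mem W P) fun (x₁, x₂, _, y, yh) => (x₁, x₂, y, yh))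
    (fun c => c.2.1) (fun c => (c.1, c.2.2)) (mk := fun a b => (b.1, a, b.2))
    (fun _ _ => rfl) (fun _ _ => rfl) ε (fun t => (x₁ t, y t, v t))
  rw [law_law, mutualInfo_law] at h
  rw [← law_joint1_x2 W P]
  exact h

lemma exists_packing_slot1_both : ∃ κ : ℝ, ∀ (ε : ℝ) (n : ℕ) (y : Fin n → Y11)
    (v : Fin n → Yh),
    expect (piPmf fun _ : Fin n => P.p11) (fun x₁ => expect (piPmf fun _ : Fin n => P.p21)
      (fun x₂ => ind (TypSlot1 W P ε x₁ x₂ y v))) ≤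
      (2 : ℝ) ^ (-(n * (mutualInfo (joint1 W P) (fun (x₁, x₂, _, _, _) => (x₁, x₂))
        (fun (_, _, _, y, yh) => (y, yh)) - ε * κ))) := by
  refine ⟨absInfo (law (joint1 W P) fun (x₁, x₂, _, y, yh) => (x₁, x₂, y, yh))
    (fun c => (c.1, c.2.1)) (fun c => c.2.2), fun ε n y v => ?_⟩
  have h := packing (law_mem (joint1_mem W P) fun (x₁, x₂, _, y, yh) => (x₁, x₂, y, yh))
    (fun c => (c.1, c.2.1)) (fun c => c.2.2) (mk := fun a b => (a.1, a.2, b))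
    (fun _ _ => rfl) (fun _ _ => rfl) ε (fun t => (y t, v t))
  rw [law_law, mutualInfo_law] at h
  -- The inputs of the two sources are independent, so a pair of codewords drawn separately has the
  -- law that packing asks of a single codeword of pairs.
  have h2 := law_joint1_x12 W P
  refine le_trans (le_of_eq ?_) h
  refine Eq.trans ?_ (congrArg (fun p => expect (piPmf fun _ : Fin n => p) _) h2.symm)
  rw [expect_pi_compProd]
  rfl

lemma exists_packing_slot2_left : ∃ κ : ℝ, ∀ (ε : ℝ) (m : ℕ) (x₂ : Fin m → X22)
    (r : Fin m → XR) (y : Fin m → Y12),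
    expect (piPmf fun _ : Fin m => P.p12) (fun x₁ => ind (TypSlot2 W P ε x₁ x₂ r y)) ≤
      (2 : ℝ) ^ (-(m * (mutualInfo (joint2 W P) (fun (x₁, _, _, _) => x₁)
        (fun (_, x₂, xR, y) => (x₂, xR, y)) - ε * κ))) := by
  refine ⟨absInfo (law (joint2 W P) fun (x₁, x₂, xR, y) => (x₁, x₂, xR, y)) Prod.fst Prod.snd,
    fun ε m x₂ r y => ?_⟩
  have h := packing (law_mem (joint2_mem W P) fun (x₁, x₂, xR, y) => (x₁, x₂, xR, y))
    Prod.fst Prod.snd (mk := Prod.mk) (fun _ _ => rfl) (fun _ _ => rfl) ε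
    (fun t => (x₂ t, r t, y t))
  rw [law_law, mutualInfo_law] at h
  rw [← law_joint2_x1 W P]
  exact h

lemma exists_packing_slot2_right : ∃ κ : ℝ, ∀ (ε : ℝ) (m : ℕ) (x₁ : Fin m → X12)
    (r : Fin m → XR) (y : Fin m → Y12),
    expect (piPmf fun _ : Fin m => P.p22) (fun x₂ => ind (TypSlot2 W P ε x₁ x₂ r y)) ≤
      (2 : ℝ) ^ (-(m * (mutualInfo (joint2 W P) (fun (_, x₂, _, _) => x₂)
        (fun (x₁, _, xR, y) => (x₁, xR, y)) - ε * κ))) := by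
  refine ⟨absInfo (law (joint2 W P) fun (x₁, x₂, xR, y) => (x₁, x₂, xR, y))
    (fun c => c.2.1) (fun c => (c.1, c.2.2)), fun ε m x₁ r y => ?_⟩
  have h := packing (law_mem (joint2_mem W P) fun (x₁, x₂, xR, y) => (x₁, x₂, xR, y))
    (fun c => c.2.1) (fun c => (c.1, c.2.2)) (mk := fun a b => (b.1, a, b.2))
    (fun _ _ => rfl) (fun _ _ => rfl) ε (fun t => (x₁ t, r t, y t))
  rw [law_law, mutualInfo_law] at h
  rw [← law_joint2_x2 W P]
  exact h

lemma exists_packing_slot2_both : ∃ κ : ℝ, ∀ (ε : ℝ) (m : ℕ) (r : Fin m → XR)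
    (y : Fin m → Y12),
    expect (piPmf fun _ : Fin m => P.p12) (fun x₁ => expect (piPmf fun _ : Fin m => P.p22)
      (fun x₂ => ind (TypSlot2 W P ε x₁ x₂ r y))) ≤
      (2 : ℝ) ^ (-(m * (mutualInfo (joint2 W P) (fun (x₁, x₂, _, _) => (x₁, x₂))
        (fun (_, _, xR, y) => (xR, y)) - ε * κ))) := by
  refine ⟨absInfo (law (joint2 W P) fun (x₁, x₂, xR, y) => (x₁, x₂, xR, y))
    (fun c => (c.1, c.2.1)) (fun c => c.2.2), fun ε m r y => ?_⟩
  have h := packing (law_mem (joint2_mem W P) fun (x₁, x₂, xR, y) => (x₁, x₂, xR, y))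
    (fun c => (c.1, c.2.1)) (fun c => c.2.2) (mk := fun a b => (a.1, a.2, b))
    (fun _ _ => rfl) (fun _ _ => rfl) ε (fun t => (r t, y t))
  rw [law_law, mutualInfo_law] at h
  have h2 := law_joint2_x12 W P
  refine le_trans (le_of_eq ?_) h
  refine Eq.trans ?_ (congrArg (fun p => expect (piPmf fun _ : Fin m => p) _) h2.symm)
  rw [expect_pi_compProd]
  rfl

lemma exists_covering : ∃ κ : ℝ, ∀ (ε' ε : ℝ) (n : ℕ), ε' < ε → 0 < n → ∀ yR : Fin n → YR,
    Typical ε' (lawYR W P) yR →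
    (2 : ℝ) ^ (-(n * (infoRelayQuant W P + ε * κ))) *
      (1 - chebyshevConst (compProd (lawYR W P) P.quant) (ε - ε') / n) ≤
    expect (piPmf fun _ : Fin n => lawYh W P) (fun v => ind (TypQuant W P ε yR v)) := by
  refine ⟨absInfo (compProd (lawYR W P) P.quant) Prod.snd Prod.fst,
    fun ε' ε n hε hn yR hy => ?_⟩
  have h := covering (lawYR_mem W P) P.quant_mem hε hn hy
  rw [mutualInfo_comm, law_quant_snd] at h
  have h2 : mutualInfo (compProd (lawYR W P) P.quant) Prod.fst Prod.snd = infoRelayQuant W P := by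
    rw [← law_joint1_quant, mutualInfo_law]; rfl
  rw [h2] at h
  simp only [typQuant_iff]
  exact h

end

section

/-! ### Union bounds over wrong codewords. -/

section

variable {A B C D : Type*} [Fintype A] [Fintype B] [Fintype C] [Fintype D]

lemma expect_expect_eq (p : A → ℝ) (q : B → ℝ) (F : A → B → ℝ) :
    expect p (fun a => expect q (fun b => F a b)) =
      expect (compProd p fun _ => q) (fun ab => F ab.1 ab.2) := by
  rw [expect_compProd]

lemma expect_pi_split_le {ι : Type*} [Fintype ι] [DecidableEq ι] {p : A → ℝ} {q : B → ℝ}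
    {F : A → (ι → B) → ℝ} {c : ℝ} (hq : q ∈ stdSimplex ℝ B) (i : ι)
    (h : ∀ b, expect p (fun a => expect (piPmf fun _ : ι => q)
      (fun y => F a (Function.update y i b))) ≤ c) :
    expect p (fun a => expect (piPmf fun _ : ι => q) (fun y => F a y)) ≤ c := by
  have h1 : ∀ a, expect (piPmf fun _ : ι => q) (fun y => F a y) = expect q (fun b =>
      expect (piPmf fun _ : ι => q) (fun y => F a (Function.update y i b))) :=
    fun a => expect_pi_split (fun _ => hq) i _
  simp only [h1]
  exact expect_swap_le hq h

/-- The union bound over pairs of wrong indices of two independent codebooks. -/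
lemma expect_pi_pi_exists_le {ι κ : Type*} [Fintype ι] [DecidableEq ι] [Fintype κ] [DecidableEq κ]
    {p : A → ℝ} {q : B → ℝ} (hp : p ∈ stdSimplex ℝ A) (hq : q ∈ stdSimplex ℝ B) (i₀ : ι) (j₀ : κ)
    (T : A → B → Prop) {r : ℝ} (hr : expect p (fun a => expect q fun b => ind (T a b)) ≤ r) :
    expect (piPmf fun _ : ι => p) (fun x => expect (piPmf fun _ : κ => q)
      (fun y => ind (∃ i, i ≠ i₀ ∧ ∃ j, j ≠ j₀ ∧ T (x i) (y j)))) ≤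
      ((Fintype.card ι : ℝ) - 1) * ((Fintype.card κ : ℝ) - 1) * r := by
  have h1 : ∀ (x : ι → A) (y : κ → B), ind (∃ i, i ≠ i₀ ∧ ∃ j, j ≠ j₀ ∧ T (x i) (y j)) ≤
      ∑ i ∈ Finset.univ.erase i₀, ∑ j ∈ Finset.univ.erase j₀, ind (T (x i) (y j)) := by
    intro x y
    refine le_trans ?_ (Finset.sum_le_sum fun i _ => ind_exists_le (Finset.univ.erase j₀) _)
    refine le_trans (ind_mono ?_) (ind_exists_le (Finset.univ.erase i₀) _)
    rintro ⟨i, hi, j, hj, hT⟩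
    exact ⟨i, by simp [hi], j, by simp [hj], hT⟩
  have hP := piPmf_mem fun _ : ι => hp
  have hQ := piPmf_mem fun _ : κ => hq
  refine (expect_mono hP fun x => expect_mono hQ (h1 x)).trans ?_
  simp only [expect_sum]
  have h2 : ∀ i j, expect (piPmf fun _ : ι => p) (fun x => expect (piPmf fun _ : κ => q)
      (fun y => ind (T (x i) (y j)))) = expect p (fun a => expect q fun b => ind (T a b)) := by
    intro i j
    rw [← expect_pi_eval (fun _ : ι => hp) i (fun a => expect q fun b => ind (T a b))]
    congr 1
    funext x
    exact expect_pi_eval (fun _ : κ => hq) j (fun b => ind (T (x i) b))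
  simp only [h2]
  rw [Finset.sum_const, Finset.sum_const, Finset.card_erase_of_mem (Finset.mem_univ _),
    Finset.card_erase_of_mem (Finset.mem_univ _), Finset.card_univ, Finset.card_univ,
    nsmul_eq_mul, nsmul_eq_mul, Nat.cast_sub (Fintype.card_pos_iff.2 ⟨i₀⟩),
    Nat.cast_sub (Fintype.card_pos_iff.2 ⟨j₀⟩), Nat.cast_one, ← mul_assoc]
  refine mul_le_mul_of_nonneg_left hr (mul_nonneg ?_ ?_)
  · have : (1 : ℝ) ≤ Fintype.card ι := by exact_mod_cast Fintype.card_pos_iff.2 ⟨i₀⟩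
    linarith
  · have : (1 : ℝ) ≤ Fintype.card κ := by exact_mod_cast Fintype.card_pos_iff.2 ⟨j₀⟩
    linarith

/-- The union bound over the wrong indices of a codebook in which one codeword is fixed. -/
lemma expect_update_exists_le {ι : Type*} [Fintype ι] [DecidableEq ι]
    {p : A → ℝ} (hp : p ∈ stdSimplex ℝ A) (i₀ : ι) (a : A)
    (T : A → Prop) {r : ℝ} (hr : expect p (fun a => ind (T a)) ≤ r) :
    expect (piPmf fun _ : ι => p) (fun x => ind (∃ i, i ≠ i₀ ∧ T (Function.update x i₀ a i))) ≤
      ((Fintype.card ι : ℝ) - 1) * r := by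
  refine le_trans (expect_mono (piPmf_mem fun _ => hp) fun x => ind_mono ?_)
    (expect_pi_exists_le (fun _ : ι => hp) i₀ T fun _ => hr)
  rintro ⟨i, hi, hT⟩
  rw [Function.update_of_ne hi] at hT
  exact ⟨i, hi, hT⟩

/-- The two halves of a codeword pair are independent, so passing both slot tests costs the product
of the probabilities. This is the origin of the sums over slots in the rate bounds. -/
lemma expect_mul_expect_le {p : A → ℝ} {q : B → ℝ} (hp : p ∈ stdSimplex ℝ A)
    {T : A → Prop} {V : B → Prop} {r s : ℝ} (hs : 0 ≤ s)
    (hr : expect p (fun a => ind (T a)) ≤ r) (hq : expect q (fun b => ind (V b)) ≤ s) :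
    expect (compProd p fun _ => q) (fun ab => ind (T ab.1 ∧ V ab.2)) ≤ r * s := by
  rw [expect_compProd]
  simp only [ind_and, expect_const_mul]
  calc expect p (fun a => ind (T a) * expect q fun b => ind (V b))
      ≤ expect p (fun a => ind (T a) * s) :=
        expect_mono hp fun a => mul_le_mul_of_nonneg_left hq (ind_nonneg _)
    _ = expect p (fun a => ind (T a)) * s := expect_mul_const _ _ _
    _ ≤ r * s := mul_le_mul_of_nonneg_right hr hs

lemma expect_mul_expect_le₂ {p : A → ℝ} {q : B → ℝ} {p' : C → ℝ} {q' : D → ℝ}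
    (hp : p ∈ stdSimplex ℝ A) (hp' : p' ∈ stdSimplex ℝ C)
    {T : A → C → Prop} {V : B → D → Prop} {r s : ℝ} (hs : 0 ≤ s)
    (hr : expect p (fun a => expect p' fun c => ind (T a c)) ≤ r)
    (hq : expect q (fun b => expect q' fun d => ind (V b d)) ≤ s) :
    expect (compProd p fun _ => q) (fun ab => expect (compProd p' fun _ => q')
      (fun cd => ind (T ab.1 cd.1 ∧ V ab.2 cd.2))) ≤ r * s := by
  rw [expect_compProd]
  simp only [expect_compProd, ind_and]
  have h1 : ∀ a, expect q (fun b => expect p' fun c => expect q' fun d =>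
      ind (T a c) * ind (V b d)) =
      expect p' (fun c => ind (T a c)) * expect q (fun b => expect q' fun d => ind (V b d)) := by
    intro a
    simp only [expect_const_mul, expect_mul_const]
  simp only [h1, expect_mul_const]
  exact (mul_le_mul_of_nonneg_left hq (expect_nonneg hp fun _ => expect_nonneg hp' fun _ =>
    ind_nonneg _)).trans (mul_le_mul_of_nonneg_right hr hs)

end

variable {X11 X21 X12 X22 XR YR Y11 Y12 Yh : Type*}
  [Fintype X11] [Fintype X21] [Fintype X12] [Fintype X22] [Fintype XR]
  [Fintype YR] [Fintype Y11] [Fintype Y12] [Fintype Yh]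
  (W : Channel X11 X21 X12 X22 XR YR Y11 Y12) (P : InputDist X11 X21 X12 X22 XR YR Yh)

/-! ### Averages over the random codebooks and the channel -/

/-- The law of a pair of codewords of source 1. -/
def src1 (n m : ℕ) : (Fin n → X11) × (Fin m → X12) → ℝ :=
  compProd (piPmf fun _ => P.p11) fun _ => piPmf fun _ => P.p12

/-- The law of a pair of codewords of source 2. -/
def src2 (n m : ℕ) : (Fin n → X21) × (Fin m → X22) → ℝ :=
  compProd (piPmf fun _ => P.p21) fun _ => piPmf fun _ => P.p22

/-- The law of the slot 1 outputs. -/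
def out1 {n : ℕ} (x₁ : Fin n → X11) (x₂ : Fin n → X21) : (Fin n → YR × Y11) → ℝ :=
  piPmf fun t => W.slot1 (x₁ t) (x₂ t)

/-- The law of the slot 2 output. -/
def out2 {m : ℕ} (x₁ : Fin m → X12) (x₂ : Fin m → X22) (r : Fin m → XR) : (Fin m → Y12) → ℝ :=
  piPmf fun t => W.slot2 (x₁ t) (x₂ t) (r t)

lemma src1_mem (n m : ℕ) : src1 P n m ∈ stdSimplex ℝ _ :=
  compProd_mem (piPmf_mem fun _ => P.p11_mem) fun _ => piPmf_mem fun _ => P.p12_mem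

lemma src2_mem (n m : ℕ) : src2 P n m ∈ stdSimplex ℝ _ :=
  compProd_mem (piPmf_mem fun _ => P.p21_mem) fun _ => piPmf_mem fun _ => P.p22_mem

lemma out1_mem {n : ℕ} (x₁ : Fin n → X11) (x₂ : Fin n → X21) : out1 W x₁ x₂ ∈ stdSimplex ℝ _ :=
  piPmf_mem fun _ => W.slot1_mem _ _

lemma out2_mem {m : ℕ} (x₁ : Fin m → X12) (x₂ : Fin m → X22) (r : Fin m → XR) :
    out2 W x₁ x₂ r ∈ stdSimplex ℝ _ :=
  piPmf_mem fun _ => W.slot2_mem _ _ _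

variable {n m M₁ M₂ S B : ℕ}

/-- The average over random codebooks and the channel, given the messages `w₁`, `w₂` and the
quantizer `U`. -/
def avg (U : (Fin S × Fin B → Fin n → Yh) → (Fin n → YR) → Fin S × Fin B)
    (w₁ : Fin M₁) (w₂ : Fin M₂)
    (F : (Fin M₁ → (Fin n → X11) × (Fin m → X12)) → (Fin M₂ → (Fin n → X21) × (Fin m → X22)) →
      (Fin S × Fin B → Fin n → Yh) → (Fin n → YR × Y11) → (Fin S → Fin m → XR) →
      (Fin m → Y12) → ℝ) : ℝ :=
  expect (piPmf fun _ : Fin M₁ => src1 P n m) fun c₁ =>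
  expect (piPmf fun _ : Fin M₂ => src2 P n m) fun c₂ =>
  expect (piPmf fun _ : Fin S × Fin B => piPmf fun _ : Fin n => lawYh W P) fun v =>
  expect (out1 W (c₁ w₁).1 (c₂ w₂).1) fun z =>
  expect (piPmf fun _ : Fin S => piPmf fun _ : Fin m => P.pR) fun r =>
  expect (out2 W (c₁ w₁).2 (c₂ w₂).2 (r (U v fun t => (z t).1).1)) fun y =>
    F c₁ c₂ v z r y

variable {W P}
variable {U : (Fin S × Fin B → Fin n → Yh) → (Fin n → YR) → Fin S × Fin B}
  {w₁ : Fin M₁} {w₂ : Fin M₂}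

lemma cb1_mem : (piPmf fun _ : Fin M₁ => src1 P n m) ∈ stdSimplex ℝ _ :=
  piPmf_mem fun _ => src1_mem P n m

lemma cb2_mem : (piPmf fun _ : Fin M₂ => src2 P n m) ∈ stdSimplex ℝ _ :=
  piPmf_mem fun _ => src2_mem P n m

variable (W P) in
lemma cbh_mem {J : Type*} [Fintype J] [DecidableEq J] :
    (piPmf fun _ : J => piPmf fun _ : Fin n => lawYh W P) ∈ stdSimplex ℝ _ :=
  piPmf_mem fun _ => piPmf_mem fun _ => lawYh_mem W P

variable (P) in
lemma cbr_mem : (piPmf fun _ : Fin S => piPmf fun _ : Fin m => P.pR) ∈ stdSimplex ℝ _ :=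
  piPmf_mem fun _ => piPmf_mem fun _ => P.pR_mem

lemma avg_mono {F G : (Fin M₁ → (Fin n → X11) × (Fin m → X12)) →
      (Fin M₂ → (Fin n → X21) × (Fin m → X22)) →
      (Fin S × Fin B → Fin n → Yh) → (Fin n → YR × Y11) → (Fin S → Fin m → XR) →
      (Fin m → Y12) → ℝ} (h : ∀ c₁ c₂ v z r y, F c₁ c₂ v z r y ≤ G c₁ c₂ v z r y) :
    avg W P U w₁ w₂ F ≤ avg W P U w₁ w₂ G :=
  expect_mono cb1_mem fun _ => expect_mono cb2_mem fun _ => expect_mono (cbh_mem W P) fun _ =>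
    expect_mono (out1_mem W _ _) fun _ => expect_mono (cbr_mem P) fun _ =>
      expect_mono (out2_mem W _ _ _) fun _ => h _ _ _ _ _ _

lemma avg_add (F G : (Fin M₁ → (Fin n → X11) × (Fin m → X12)) →
      (Fin M₂ → (Fin n → X21) × (Fin m → X22)) →
      (Fin S × Fin B → Fin n → Yh) → (Fin n → YR × Y11) → (Fin S → Fin m → XR) →
      (Fin m → Y12) → ℝ) :
    avg W P U w₁ w₂ (fun c₁ c₂ v z r y => F c₁ c₂ v z r y + G c₁ c₂ v z r y) =
      avg W P U w₁ w₂ F + avg W P U w₁ w₂ G := by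
  simp only [avg, expect_add]

/-- Averages over slot 1. -/
lemma avg_slot1 (G : (Fin n → X11 × X21 × YR × Y11) → (Fin S × Fin B → Fin n → Yh) → ℝ) :
    avg W P U w₁ w₂ (fun c₁ c₂ v z (_ : Fin S → Fin m → XR) (_ : Fin m → Y12) =>
      G (fun t => ((c₁ w₁).1 t, (c₂ w₂).1 t, z t)) v) =
    expect (piPmf fun _ : Fin n => chan1 W P) (fun ω =>
      expect (piPmf fun _ : Fin S × Fin B => piPmf fun _ : Fin n => lawYh W P) fun v => G ω v) := by
  unfold avg
  simp only [expect_const (out2_mem W _ _ _), expect_const (cbr_mem P)]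
  have h1 := expect_pi_eval (fun _ : Fin M₁ => src1_mem P n m) w₁ (fun a =>
    expect (piPmf fun _ : Fin M₂ => src2 P n m) fun c₂ =>
      expect (piPmf fun _ : Fin S × Fin B => piPmf fun _ : Fin n => lawYh W P) fun v =>
        expect (out1 W a.1 (c₂ w₂).1) fun z => G (fun t => (a.1 t, (c₂ w₂).1 t, z t)) v)
  rw [h1]
  have h2 : ∀ a : (Fin n → X11) × (Fin m → X12), _ := fun a =>
    expect_pi_eval (fun _ : Fin M₂ => src2_mem P n m) w₂ (fun b =>
      expect (piPmf fun _ : Fin S × Fin B => piPmf fun _ : Fin n => lawYh W P) fun v =>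
        expect (out1 W a.1 b.1) fun z => G (fun t => (a.1 t, b.1 t, z t)) v)
  simp only [h2]
  unfold src1 src2
  simp only [expect_compProd, expect_const (piPmf_mem fun _ : Fin m => P.p12_mem),
    expect_const (piPmf_mem fun _ : Fin m => P.p22_mem)]
  unfold chan1
  rw [expect_pi_compProd]
  congr 1
  funext x₁
  rw [expect_pi_compProd]
  congr 1
  funext x₂
  rw [expect_comm]
  rfl

/-- Given slot 1 and the quantization codebook the bin is fixed, while its relay codeword is still
fresh. So the slot 2 letters are independent with the prescribed joint law, and the law of large
numbers applies. -/
lemma avg_not_typSlot2_le {ε : ℝ} (hε : 0 < ε) (hm : 0 < m) :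
    avg (m := m) W P U w₁ w₂ (fun c₁ c₂ v z r y => ind (¬ TypSlot2 W P ε (c₁ w₁).2 (c₂ w₂).2
      (r (U v fun t => (z t).1).1) y)) ≤ chebyshevConst (joint2 W P) ε / m := by
  unfold avg
  have h1 := expect_pi_eval (fun _ : Fin M₁ => src1_mem P n m) w₁ (fun a =>
    expect (piPmf fun _ : Fin M₂ => src2 P n m) fun c₂ =>
    expect (piPmf fun _ : Fin S × Fin B => piPmf fun _ : Fin n => lawYh W P) fun v =>
    expect (out1 W a.1 (c₂ w₂).1) fun z =>
    expect (piPmf fun _ : Fin S => piPmf fun _ : Fin m => P.pR) fun r =>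
    expect (out2 W a.2 (c₂ w₂).2 (r (U v fun t => (z t).1).1)) fun y =>
      ind (¬ TypSlot2 W P ε a.2 (c₂ w₂).2 (r (U v fun t => (z t).1).1) y))
  rw [h1]
  have h2 : ∀ a : (Fin n → X11) × (Fin m → X12), _ := fun a =>
    expect_pi_eval (fun _ : Fin M₂ => src2_mem P n m) w₂ (fun b =>
      expect (piPmf fun _ : Fin S × Fin B => piPmf fun _ : Fin n => lawYh W P) fun v =>
      expect (out1 W a.1 b.1) fun z =>
      expect (piPmf fun _ : Fin S => piPmf fun _ : Fin m => P.pR) fun r =>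
      expect (out2 W a.2 b.2 (r (U v fun t => (z t).1).1)) fun y =>
        ind (¬ TypSlot2 W P ε a.2 b.2 (r (U v fun t => (z t).1).1) y))
  simp only [h2]
  unfold src1 src2
  simp only [expect_compProd]
  refine expect_le (piPmf_mem fun _ => P.p11_mem) fun x₁ => ?_
  refine expect_swap_le (piPmf_mem fun _ => P.p21_mem) fun x₂ => ?_
  -- The two slot 2 codewords are merged into one variable so that they can be moved past the slot 1
  -- variables together.
  rw [expect_expect_eq]
  refine expect_swap_le (cbh_mem W P) fun v => ?_
  refine expect_swap_le (out1_mem W _ _) fun z => ?_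
  rw [expect_compProd]
  set s := (U v fun t => (z t).1).1
  have h3 : ∀ (a : Fin m → X12) (b : Fin m → X22), _ := fun a b =>
    expect_pi_eval (fun _ : Fin S => piPmf_mem fun _ : Fin m => P.pR_mem) s (fun r =>
      expect (out2 W a b r) fun y => ind (¬ TypSlot2 W P ε a b r y))
  simp only [h3]
  refine le_trans (le_of_eq ?_) (expect_iid_not_typical_le (joint2_mem W P) hε hm)
  have h4 : ∀ x : Fin m → X12 × X22 × XR × Y12, Typical ε (joint2 W P) x ↔
      TypSlot2 W P ε (fun t => (x t).1) (fun t => (x t).2.1) (fun t => (x t).2.2.1)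
        (fun t => (x t).2.2.2) := by
    intro x
    have : law (joint2 W P) (fun (x₁, x₂, xR, y) => (x₁, x₂, xR, y)) = joint2 W P := by
      funext a
      exact law_apply_injective (joint2 W P) Function.injective_id a
    unfold TypSlot2
    rw [this]
  simp only [h4]
  rw [joint2_eq]
  rw [expect_pi_compProd]
  congr 1
  funext a
  rw [expect_pi_compProd]
  congr 1
  funext b
  rw [expect_pi_compProd]
  rfl

/-- The slot 2 output depends on the relay codebook only through the codeword that is sent. With
that codeword split off, the others are independent of `y`, and packing applies. -/
lemma avg_wrong_bin_le {ε ρ : ℝ}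
    (hρ : ∀ y : Fin m → Y12, expect (piPmf fun _ : Fin m => P.pR)
      (fun x => ind (TypBin W P ε x y)) ≤ ρ) :
    avg (m := m) W P U w₁ w₂ (fun _ _ v z r y => ind (∃ s, s ≠ (U v fun t => (z t).1).1 ∧
      TypBin W P ε (r s) y)) ≤ ((S : ℝ) - 1) * ρ := by
  unfold avg
  refine expect_le cb1_mem fun c₁ => expect_le cb2_mem fun c₂ =>
    expect_le (cbh_mem W P) fun v => expect_le (out1_mem W _ _) fun z => ?_
  set s := (U v fun t => (z t).1).1
  rw [expect_pi_split (fun _ : Fin S => piPmf_mem fun _ : Fin m => P.pR_mem) s]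
  simp only [Function.update_self]
  refine expect_le (piPmf_mem fun _ => P.pR_mem) fun a => ?_
  refine expect_swap_le (out2_mem W _ _ _) fun y => ?_
  have := expect_update_exists_le (piPmf_mem fun _ : Fin m => P.pR_mem) s a
    (fun x => TypBin W P ε x y) (hρ y)
  rwa [Fintype.card_fin] at this

/-- Apart from the codeword of `w₁`, the codebook of source 1 influences neither relay nor outputs.
It is averaged last, against fixed values of all the rest. -/
lemma avg_wrong_left_le {ε ρ σ : ℝ} (hσ : 0 ≤ σ)
    (hρ : ∀ (x₂ : Fin n → X21) (y : Fin n → Y11) (v : Fin n → Yh),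
      expect (piPmf fun _ : Fin n => P.p11) (fun x₁ => ind (TypSlot1 W P ε x₁ x₂ y v)) ≤ ρ)
    (hρ' : ∀ (x₂ : Fin m → X22) (r : Fin m → XR) (y : Fin m → Y12),
      expect (piPmf fun _ : Fin m => P.p12) (fun x₁ => ind (TypSlot2 W P ε x₁ x₂ r y)) ≤ σ) :
    avg (m := m) W P U w₁ w₂ (fun c₁ c₂ v z r y => ind (∃ w, w ≠ w₁ ∧
      (TypSlot1 W P ε (c₁ w).1 (c₂ w₂).1 (fun t => (z t).2) (v (U v fun t => (z t).1)) ∧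
      TypSlot2 W P ε (c₁ w).2 (c₂ w₂).2 (r (U v fun t => (z t).1).1) y))) ≤
      ((M₁ : ℝ) - 1) * (ρ * σ) := by
  unfold avg
  rw [expect_pi_split (fun _ : Fin M₁ => src1_mem P n m) w₁]
  simp only [Function.update_self]
  refine expect_le (src1_mem P n m) fun a => ?_
  refine expect_swap_le cb2_mem fun c₂ => expect_swap_le (cbh_mem W P) fun v =>
    expect_swap_le (out1_mem W _ _) fun z => expect_swap_le (cbr_mem P) fun r =>
      expect_swap_le (out2_mem W _ _ _) fun y => ?_
  have := expect_update_exists_le (src1_mem P n m) w₁ a (fun x =>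
    TypSlot1 W P ε x.1 (c₂ w₂).1 (fun t => (z t).2) (v (U v fun t => (z t).1)) ∧
      TypSlot2 W P ε x.2 (c₂ w₂).2 (r (U v fun t => (z t).1).1) y)
    (expect_mul_expect_le (piPmf_mem fun _ => P.p11_mem) hσ (hρ _ _ _) (hρ' _ _ _))
  rwa [Fintype.card_fin] at this

lemma avg_wrong_right_le {ε ρ σ : ℝ} (hσ : 0 ≤ σ)
    (hρ : ∀ (x₁ : Fin n → X11) (y : Fin n → Y11) (v : Fin n → Yh),
      expect (piPmf fun _ : Fin n => P.p21) (fun x₂ => ind (TypSlot1 W P ε x₁ x₂ y v)) ≤ ρ)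
    (hρ' : ∀ (x₁ : Fin m → X12) (r : Fin m → XR) (y : Fin m → Y12),
      expect (piPmf fun _ : Fin m => P.p22) (fun x₂ => ind (TypSlot2 W P ε x₁ x₂ r y)) ≤ σ) :
    avg (m := m) W P U w₁ w₂ (fun c₁ c₂ v z r y => ind (∃ w, w ≠ w₂ ∧
      (TypSlot1 W P ε (c₁ w₁).1 (c₂ w).1 (fun t => (z t).2) (v (U v fun t => (z t).1)) ∧
      TypSlot2 W P ε (c₁ w₁).2 (c₂ w).2 (r (U v fun t => (z t).1).1) y))) ≤
      ((M₂ : ℝ) - 1) * (ρ * σ) := by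
  unfold avg
  refine expect_le cb1_mem fun c₁ => ?_
  rw [expect_pi_split (fun _ : Fin M₂ => src2_mem P n m) w₂]
  simp only [Function.update_self]
  refine expect_le (src2_mem P n m) fun a => ?_
  refine expect_swap_le (cbh_mem W P) fun v =>
    expect_swap_le (out1_mem W _ _) fun z => expect_swap_le (cbr_mem P) fun r =>
      expect_swap_le (out2_mem W _ _ _) fun y => ?_
  have := expect_update_exists_le (src2_mem P n m) w₂ a (fun x =>
    TypSlot1 W P ε (c₁ w₁).1 x.1 (fun t => (z t).2) (v (U v fun t => (z t).1)) ∧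
      TypSlot2 W P ε (c₁ w₁).2 x.2 (r (U v fun t => (z t).1).1) y)
    (expect_mul_expect_le (piPmf_mem fun _ => P.p21_mem) hσ (hρ _ _ _) (hρ' _ _ _))
  rwa [Fintype.card_fin] at this

lemma avg_wrong_both_le {ε ρ σ : ℝ} (hσ : 0 ≤ σ)
    (hρ : ∀ (y : Fin n → Y11) (v : Fin n → Yh),
      expect (piPmf fun _ : Fin n => P.p11) (fun x₁ => expect (piPmf fun _ : Fin n => P.p21)
        (fun x₂ => ind (TypSlot1 W P ε x₁ x₂ y v))) ≤ ρ)
    (hρ' : ∀ (r : Fin m → XR) (y : Fin m → Y12),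
      expect (piPmf fun _ : Fin m => P.p12) (fun x₁ => expect (piPmf fun _ : Fin m => P.p22)
        (fun x₂ => ind (TypSlot2 W P ε x₁ x₂ r y))) ≤ σ) :
    avg (m := m) W P U w₁ w₂ (fun c₁ c₂ v z r y => ind (∃ w, w ≠ w₁ ∧ ∃ w', w' ≠ w₂ ∧
      (TypSlot1 W P ε (c₁ w).1 (c₂ w').1 (fun t => (z t).2) (v (U v fun t => (z t).1)) ∧
      TypSlot2 W P ε (c₁ w).2 (c₂ w').2 (r (U v fun t => (z t).1).1) y))) ≤
      ((M₁ : ℝ) - 1) * ((M₂ : ℝ) - 1) * (ρ * σ) := by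
  unfold avg
  rw [expect_pi_split (fun _ : Fin M₁ => src1_mem P n m) w₁]
  simp only [Function.update_self]
  refine expect_le (src1_mem P n m) fun a => ?_
  refine expect_pi_split_le (src2_mem P n m) w₂ fun b => ?_
  simp only [Function.update_self]
  rw [expect_expect_eq]
  refine expect_swap_le (cbh_mem W P) fun v =>
    expect_swap_le (out1_mem W _ _) fun z => expect_swap_le (cbr_mem P) fun r =>
      expect_swap_le (out2_mem W _ _ _) fun y => ?_
  rw [expect_compProd]
  have := expect_pi_pi_exists_le (src1_mem P n m) (src2_mem P n m) w₁ w₂ (fun x x' =>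
    TypSlot1 W P ε x.1 x'.1 (fun t => (z t).2) (v (U v fun t => (z t).1)) ∧
      TypSlot2 W P ε x.2 x'.2 (r (U v fun t => (z t).1).1) y)
    (expect_mul_expect_le₂ (T := fun x₁ x₂ => TypSlot1 W P ε x₁ x₂ (fun t => (z t).2)
        (v (U v fun t => (z t).1)))
      (V := fun x₁ x₂ => TypSlot2 W P ε x₁ x₂ (r (U v fun t => (z t).1).1) y)
      (piPmf_mem fun _ => P.p11_mem) (piPmf_mem fun _ => P.p21_mem) hσ (hρ _ _) (hρ' _ _))
  rw [Fintype.card_fin, Fintype.card_fin] at this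
  refine le_trans (expect_mono cb1_mem fun c₁ => expect_mono cb2_mem fun c₂ => ind_mono ?_) this
  rintro ⟨w, hw, w', hw', hT⟩
  rw [Function.update_of_ne hw, Function.update_of_ne hw'] at hT
  exact ⟨w, hw, w', hw', hT⟩

/-- No quantization sequence is typical with the relay reception. -/
lemma avg_no_cover_le {ε'' ε' q : ℝ} (hε'' : 0 < ε'') (hn : 0 < n)
    (hq : ∀ yR : Fin n → YR, Typical ε'' (lawYR W P) yR →
      q ≤ expect (piPmf fun _ : Fin n => lawYh W P) (fun v => ind (TypQuant W P ε' yR v))) :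
    avg W P U w₁ w₂ (fun _ _ v z (_ : Fin S → Fin m → XR) (_ : Fin m → Y12) =>
      ind (∀ u, ¬ TypQuant W P ε' (fun t => (z t).1) (v u))) ≤
      chebyshevConst (lawYR W P) ε'' / n + Real.exp (-(q * ((S : ℝ) * B))) := by
  have h1 := avg_slot1 (W := W) (P := P) (U := U) (w₁ := w₁) (w₂ := w₂) (m := m) (fun ω v =>
    ind (∀ u, ¬ TypQuant W P ε' (fun t => (ω t).2.2.1) (v u)))
  refine h1.le.trans ?_
  have h2 : ∀ ω : Fin n → X11 × X21 × YR × Y11,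
      (expect (piPmf fun _ : Fin S × Fin B => piPmf fun _ : Fin n => lawYh W P) fun v =>
        ind (∀ u, ¬ TypQuant W P ε' (fun t => (ω t).2.2.1) (v u))) ≤
      ind (¬ Typical ε'' (lawYR W P) (fun t => (ω t).2.2.1)) +
        Real.exp (-(q * ((S : ℝ) * B))) := by
    intro ω
    by_cases hty : Typical ε'' (lawYR W P) (fun t => (ω t).2.2.1)
    · rw [ind_false (not_not.2 hty), zero_add]
      have := expect_forall_not_le (J := Fin S × Fin B) (piPmf_mem fun _ : Fin n => lawYh_mem W P)
        (fun v => TypQuant W P ε' (fun t => (ω t).2.2.1) v) (hq _ hty)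
      simpa using this
    · rw [ind_true hty]
      have h3 : (expect (piPmf fun _ : Fin S × Fin B => piPmf fun _ : Fin n => lawYh W P) fun v =>
        ind (∀ u, ¬ TypQuant W P ε' (fun t => (ω t).2.2.1) (v u))) ≤ 1 :=
        expect_le (cbh_mem W P) fun _ => ind_le_one _
      have := Real.exp_pos (-(q * ((S : ℝ) * B)))
      linarith
  refine (expect_mono (piPmf_mem fun _ => chan1_mem W P) h2).trans ?_
  rw [expect_add, expect_const (piPmf_mem fun _ => chan1_mem W P)]
  refine add_le_add_left ?_ _
  have h3 := expect_iid_not_typical_le (lawYR_mem W P) hε'' hn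
  refine le_trans (le_of_eq ?_) h3
  conv_rhs => rw [lawYR, expect_pi_law]
  rfl

/-- The true slot 1 sequences are typical if the quantization succeeds. -/
lemma exists_avg_not_typSlot1_le (W : Channel X11 X21 X12 X22 XR YR Y11 Y12)
    (P : InputDist X11 X21 X12 X22 XR YR Yh) {ε' ε : ℝ} (hε : ε' < ε) :
    ∃ K : ℝ, ∀ {n m M₁ M₂ S B : ℕ}
      (U : (Fin S × Fin B → Fin n → Yh) → (Fin n → YR) → Fin S × Fin B)
      (w₁ : Fin M₁) (w₂ : Fin M₂), 0 < n →
      avg W P U w₁ w₂ (fun c₁ c₂ v z (_ : Fin S → Fin m → XR) (_ : Fin m → Y12) =>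
        ind (TypQuant W P ε' (fun t => (z t).1) (v (U v fun t => (z t).1)) ∧
          ¬ TypSlot1 W P ε (c₁ w₁).1 (c₂ w₂).1 (fun t => (z t).2)
            (v (U v fun t => (z t).1)))) ≤ K / n := by
  obtain ⟨k, hk, hk1, hk2⟩ := exists_kernel_chan1 W P
  have hqm : compProd (lawYR W P) P.quant ∈ stdSimplex ℝ (YR × Yh) :=
    compProd_mem (lawYR_mem W P) P.quant_mem
  set K := chebyshevConst (compProd (compProd (lawYR W P) P.quant) fun y => k y.1) (ε - ε') with hK
  refine ⟨K, fun {n m M₁ M₂ S B} U w₁ w₂ hn => ?_⟩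
  have h1 := avg_slot1 (W := W) (P := P) (U := U) (w₁ := w₁) (w₂ := w₂) (m := m) (fun ω v =>
    ind (TypQuant W P ε' (fun t => (ω t).2.2.1) (v (U v fun t => (ω t).2.2.1)) ∧
      ¬ TypSlot1 W P ε (fun t => (ω t).1) (fun t => (ω t).2.1) (fun t => (ω t).2.2.2)
        (v (U v fun t => (ω t).2.2.1))))
  refine h1.le.trans ?_
  -- With the quantization codebook fixed first, the chosen sequence is a deterministic function of
  -- `y_R`, whatever the rule `U`.
  refine expect_swap_le (cbh_mem W P) fun v => ?_
  have h2 := expect_pi_law (ι := Fin n) (chan1 W P)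
    (fun ω => (ω.2.2.1, (ω.1, ω.2.1, ω.2.2.2))) (fun x =>
      ind (TypQuant W P ε' (fun t => (x t).1) (v (U v fun t => (x t).1)) ∧
      ¬ TypSlot1 W P ε (fun t => (x t).2.1) (fun t => (x t).2.2.1) (fun t => (x t).2.2.2)
        (v (U v fun t => (x t).1))))
  refine h2.symm.le.trans ?_
  rw [hk1, expect_pi_compProd]
  refine expect_le (piPmf_mem fun _ => lawYR_mem W P) fun yR => ?_
  set vu := v (U v fun t => yR t) with hvu
  by_cases hty : TypQuant W P ε' yR vu
  · have hty' := typQuant_iff W P |>.1 hty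
    -- The Markov step: the kernel ignores the `ŷ_R` component, so conditional typicality holds for
    -- any sequence typical with `y_R`, not only for one generated by the test channel.
    have h3 := expect_not_typical_le (k := fun y => k y.1) hqm (fun y => hk y.1) hε hn hty'
    refine le_trans (expect_mono (piPmf_mem fun _ => hk _) fun d => ind_mono ?_) h3
    rintro ⟨_, h4⟩ h5
    apply h4
    rw [← hk2] at h5
    have h6 := h5.map (fun a => (a.2.1, a.2.2.1, a.2.2.2, a.1.2))
    rw [law_law] at h6
    exact h6
  · refine expect_le (piPmf_mem fun _ => hk _) fun d => ?_
    rw [ind_false fun h => hty h.1]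
    exact div_nonneg (chebyshevConst_nonneg _ _) (Nat.cast_nonneg _)

/-- For fixed channel variables both tests are properties of single codewords, so the bin collision
bound applies. The event mentions the first fitting index instead of `U`. -/
lemma avg_wrong_quant_le {N : ℕ} {ε' ε ρ : ℝ} (e : Fin S × Fin B ≃ Fin N) (hB : 0 < B)
    (hρ : ∀ y : Fin n → Y11, expect (piPmf fun _ : Fin n => lawYh W P)
      (fun v => ind (TypDest W P ε y v)) ≤ ρ) :
    avg W P U w₁ w₂ (fun _ _ v z (_ : Fin S → Fin m → XR) (_ : Fin m → Y12) =>
      ind (∃ u u', u' ≠ u ∧ u'.1 = u.1 ∧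
        IsFirst e (fun a => TypQuant W P ε' (fun t => (z t).1) (v a)) u ∧
        TypDest W P ε (fun t => (z t).2) (v u'))) ≤ 2 * ((B : ℝ) - 1) * ρ := by
  have h1 := avg_slot1 (W := W) (P := P) (U := U) (w₁ := w₁) (w₂ := w₂) (m := m) (fun ω v =>
    ind (∃ u u', u' ≠ u ∧ u'.1 = u.1 ∧
        IsFirst e (fun a => TypQuant W P ε' (fun t => (ω t).2.2.1) (v a)) u ∧
        TypDest W P ε (fun t => (ω t).2.2.2) (v u')))
  refine h1.le.trans ?_
  refine expect_le (piPmf_mem fun _ => chan1_mem W P) fun ω => ?_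
  exact expect_bin_collision_le (piPmf_mem fun _ => lawYh_mem W P) e hB
    (fun a => TypQuant W P ε' (fun t => (ω t).2.2.1) a)
    (fun a => TypDest W P ε (fun t => (ω t).2.2.2) a) (hρ _)

end

section

variable {X11 X21 X12 X22 XR YR Y11 Y12 Yh : Type*}
  [Fintype X11] [Fintype X21] [Fintype X12] [Fintype X22] [Fintype XR]
  [Fintype YR] [Fintype Y11] [Fintype Y12] [Fintype Yh]
  (W : Channel X11 X21 X12 X22 XR YR Y11 Y12) (P : InputDist X11 X21 X12 X22 XR YR Yh)
  {n m M₁ M₂ S B : ℕ}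

/-! ### Random coding -/

lemma errorProb_eq (c : Code X11 X21 X12 X22 XR YR Y11 Y12 n m M₁ M₂) :
    errorProb W c = ((M₁ : ℝ) * M₂)⁻¹ * ∑ w₁, ∑ w₂,
      expect (out1 W (c.enc11 w₁) (c.enc21 w₂)) fun z =>
        expect (out2 W (c.enc12 w₁) (c.enc22 w₂) (c.relay fun t => (z t).1)) fun y =>
          ind (c.dec (fun t => (z t).2) y ≠ (w₁, w₂)) := by
  unfold errorProb
  congr 1
  refine Finset.sum_congr rfl fun w₁ _ => Finset.sum_congr rfl fun w₂ _ => ?_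
  unfold expect
  rw [← Equiv.sum_comp (Equiv.arrowProdEquivProdArrow (Fin n) (fun _ => YR) (fun _ => Y11)).symm,
    Fintype.sum_prod_type]
  refine Finset.sum_congr rfl fun yR _ => Finset.sum_congr rfl fun y1 _ => ?_
  rw [Finset.mul_sum]
  refine Finset.sum_congr rfl fun y2 _ => ?_
  change _ = (∏ t, W.slot1 (c.enc11 w₁ t) (c.enc21 w₂ t) (yR t, y1 t)) *
    ((∏ t, W.slot2 (c.enc12 w₁ t) (c.enc22 w₂ t) (c.relay yR t) (y2 t)) *
      ind (c.dec y1 y2 ≠ (w₁, w₂)))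
  by_cases h : c.dec y1 y2 = (w₁, w₂)
  · rw [if_pos h, ind_false (not_not.2 h), mul_zero, mul_zero]
  · rw [if_neg h, ind_true h, mul_one]

/-- The quantizer `U` chooses the first index whose quantization sequence is typical with the relay
reception. -/
def IsFirstQuantizer (ε' : ℝ) (U : (Fin S × Fin B → Fin n → Yh) → (Fin n → YR) → Fin S × Fin B) :
    Prop :=
  ∀ v yR, (∃ u, TypQuant W P ε' yR (v u)) →
    IsFirst finProdFinEquiv (fun u => TypQuant W P ε' yR (v u)) (U v yR)

lemma exists_quantizer [NeZero S] [NeZero B] (ε' : ℝ) :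
    ∃ U : (Fin S × Fin B → Fin n → Yh) → (Fin n → YR) → Fin S × Fin B,
      IsFirstQuantizer W P ε' U :=
  ⟨fun v yR => (exists_isFirst finProdFinEquiv fun u => TypQuant W P ε' yR (v u)).choose,
    fun v yR => (exists_isFirst finProdFinEquiv fun u => TypQuant W P ε' yR (v u)).choose_spec⟩

variable {W P}

/-- The scheme with given codebooks and a first-index quantizer. -/
def schemeOf {ε' : ℝ} {U : (Fin S × Fin B → Fin n → Yh) → (Fin n → YR) → Fin S × Fin B}
    (hU : IsFirstQuantizer W P ε' U)
    (c₁ : Fin M₁ → (Fin n → X11) × (Fin m → X12)) (c₂ : Fin M₂ → (Fin n → X21) × (Fin m → X22))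
    (v : Fin S × Fin B → Fin n → Yh) (r : Fin S → Fin m → XR) :
    CFScheme W P ε' n m M₁ M₂ S B where
  x11 w := (c₁ w).1
  x21 w := (c₂ w).1
  x12 w := (c₁ w).2
  x22 w := (c₂ w).2
  yhat := v
  xR := r
  quantize := U v
  quantize_spec yR h := (hU v yR h).1

variable [NeZero M₁] [NeZero M₂]

lemma errorProb_schemeOf {ε' : ℝ} (ε : ℝ)
    {U : (Fin S × Fin B → Fin n → Yh) → (Fin n → YR) → Fin S × Fin B}
    (hU : IsFirstQuantizer W P ε' U)
    (c₁ : Fin M₁ → (Fin n → X11) × (Fin m → X12)) (c₂ : Fin M₂ → (Fin n → X21) × (Fin m → X22))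
    (v : Fin S × Fin B → Fin n → Yh) (r : Fin S → Fin m → XR) :
    errorProb W ((schemeOf hU c₁ c₂ v r).toCode ε) = ((M₁ : ℝ) * M₂)⁻¹ * ∑ w₁, ∑ w₂,
      expect (out1 W (c₁ w₁).1 (c₂ w₂).1) fun z =>
        expect (out2 W (c₁ w₁).2 (c₂ w₂).2 (r (U v fun t => (z t).1).1)) fun y =>
          ind (((schemeOf hU c₁ c₂ v r).toCode ε).dec (fun t => (z t).2) y ≠ (w₁, w₂)) :=
  errorProb_eq W _

/-- The average over the codebooks of the uniform mixture of the error probabilities. -/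
lemma expect_mixture_le {E : ℝ}
    {U : (Fin S × Fin B → Fin n → Yh) → (Fin n → YR) → Fin S × Fin B}
    (G : Fin M₁ → Fin M₂ → (Fin M₁ → (Fin n → X11) × (Fin m → X12)) →
      (Fin M₂ → (Fin n → X21) × (Fin m → X22)) →
      (Fin S × Fin B → Fin n → Yh) → (Fin n → YR × Y11) → (Fin S → Fin m → XR) →
      (Fin m → Y12) → ℝ)
    (hE : ∀ (w₁ : Fin M₁) (w₂ : Fin M₂), avg (m := m) W P U w₁ w₂ (G w₁ w₂) ≤ E) :
    expect (piPmf fun _ : Fin M₁ => src1 P n m) (fun c₁ =>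
      expect (piPmf fun _ : Fin M₂ => src2 P n m) fun c₂ =>
      expect (piPmf fun _ : Fin S × Fin B => piPmf fun _ : Fin n => lawYh W P) fun v =>
      expect (piPmf fun _ : Fin S => piPmf fun _ : Fin m => P.pR) fun r =>
        ((M₁ : ℝ) * M₂)⁻¹ * ∑ w₁, ∑ w₂,
          expect (out1 W (c₁ w₁).1 (c₂ w₂).1) fun z =>
            expect (out2 W (c₁ w₁).2 (c₂ w₂).2 (r (U v fun t => (z t).1).1)) fun y =>
              G w₁ w₂ c₁ c₂ v z r y) ≤ E := by
  simp only [expect_const_mul, expect_sum]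
  have hM₁ : (0 : ℝ) < M₁ := Nat.cast_pos.2 (Nat.pos_of_ne_zero (NeZero.ne M₁))
  have hM₂ : (0 : ℝ) < M₂ := Nat.cast_pos.2 (Nat.pos_of_ne_zero (NeZero.ne M₂))
  rw [inv_mul_le_iff₀ (mul_pos hM₁ hM₂)]
  calc _ ≤ ∑ _w₁ : Fin M₁, ∑ _w₂ : Fin M₂, E := by
        refine Finset.sum_le_sum fun w₁ _ => Finset.sum_le_sum fun w₂ _ => ?_
        refine le_trans (le_of_eq ?_) (hE w₁ w₂)
        unfold avg
        congr 1; funext c₁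
        congr 1; funext c₂
        congr 1; funext v
        exact expect_comm _ _ _
    _ = _ := by simp [mul_assoc]

/-- The four codebooks are fixed one after the other, each at a value no worse than the average over
it. -/
lemma exists_errorProb_le {ε' ε E : ℝ}
    {U : (Fin S × Fin B → Fin n → Yh) → (Fin n → YR) → Fin S × Fin B}
    (hU : IsFirstQuantizer W P ε' U)
    (hE : ∀ (w₁ : Fin M₁) (w₂ : Fin M₂), avg (m := m) W P U w₁ w₂ (fun c₁ c₂ v z r y =>
      ind (((schemeOf hU c₁ c₂ v r).toCode ε).dec (fun t => (z t).2) y ≠ (w₁, w₂))) ≤ E) :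
    ∃ c : CFScheme W P ε' n m M₁ M₂ S B, errorProb W (c.toCode ε) ≤ E := by
  have hmain : expect (piPmf fun _ : Fin M₁ => src1 P n m) (fun c₁ =>
      expect (piPmf fun _ : Fin M₂ => src2 P n m) fun c₂ =>
      expect (piPmf fun _ : Fin S × Fin B => piPmf fun _ : Fin n => lawYh W P) fun v =>
      expect (piPmf fun _ : Fin S => piPmf fun _ : Fin m => P.pR) fun r =>
        errorProb W ((schemeOf hU c₁ c₂ v r).toCode ε)) ≤ E := by
    simp only [errorProb_schemeOf]
    exact expect_mixture_le (fun w₁ w₂ c₁ c₂ v z r y =>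
      ind (((schemeOf hU c₁ c₂ v r).toCode ε).dec (fun t => (z t).2) y ≠ (w₁, w₂))) hE
  obtain ⟨c₁, h₁⟩ := exists_le_expect (cb1_mem (P := P)) (fun c₁ : Fin M₁ → (Fin n → X11) × (Fin m → X12) =>
    expect (piPmf fun _ : Fin M₂ => src2 P n m) fun c₂ =>
      expect (piPmf fun _ : Fin S × Fin B => piPmf fun _ : Fin n => lawYh W P) fun v =>
      expect (piPmf fun _ : Fin S => piPmf fun _ : Fin m => P.pR) fun r =>
        errorProb W ((schemeOf hU c₁ c₂ v r).toCode ε))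
  obtain ⟨c₂, h₂⟩ := exists_le_expect (cb2_mem (P := P)) (fun c₂ : Fin M₂ → (Fin n → X21) × (Fin m → X22) =>
      expect (piPmf fun _ : Fin S × Fin B => piPmf fun _ : Fin n => lawYh W P) fun v =>
      expect (piPmf fun _ : Fin S => piPmf fun _ : Fin m => P.pR) fun r =>
        errorProb W ((schemeOf hU c₁ c₂ v r).toCode ε))
  obtain ⟨v, h₃⟩ := exists_le_expect (cbh_mem W P) (fun v : Fin S × Fin B → Fin n → Yh =>
      expect (piPmf fun _ : Fin S => piPmf fun _ : Fin m => P.pR) fun r =>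
        errorProb W ((schemeOf hU c₁ c₂ v r).toCode ε))
  obtain ⟨r, h₄⟩ := exists_le_expect (cbr_mem P) (fun r : Fin S → Fin m → XR =>
        errorProb W ((schemeOf hU c₁ c₂ v r).toCode ε))
  exact ⟨schemeOf hU c₁ c₂ v r, (((h₄.trans h₃).trans h₂).trans h₁).trans hmain⟩

-- Needed only to have some instance for the blocks in which a slot is empty, where the quantitative
-- bounds do not apply.
variable (M₁ M₂) in
lemma exists_scheme [NeZero S] [NeZero B] (n m : ℕ) (ε' ε : ℝ) :
    ∃ c : CFScheme W P ε' n m M₁ M₂ S B, errorProb W (c.toCode ε) ≤ 1 := by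
  obtain ⟨U, hU⟩ := exists_quantizer (n := n) (S := S) (B := B) W P ε'
  refine exists_errorProb_le hU fun w₁ w₂ => ?_
  exact expect_le cb1_mem fun _ => expect_le cb2_mem fun _ => expect_le (cbh_mem W P) fun _ =>
    expect_le (out1_mem W _ _) fun _ => expect_le (cbr_mem P) fun _ =>
      expect_le (out2_mem W _ _ _) fun _ => ind_le_one _

/-- The bad events that cover every decoding error. -/
lemma ind_dec_ne_le {ε' : ℝ} (ε : ℝ)
    {U : (Fin S × Fin B → Fin n → Yh) → (Fin n → YR) → Fin S × Fin B}
    (hU : IsFirstQuantizer W P ε' U)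
    (c₁ : Fin M₁ → (Fin n → X11) × (Fin m → X12)) (c₂ : Fin M₂ → (Fin n → X21) × (Fin m → X22))
    (v : Fin S × Fin B → Fin n → Yh) (z : Fin n → YR × Y11) (r : Fin S → Fin m → XR)
    (y : Fin m → Y12) (w₁ : Fin M₁) (w₂ : Fin M₂) :
    ind (((schemeOf hU c₁ c₂ v r).toCode ε).dec (fun t => (z t).2) y ≠ (w₁, w₂)) ≤
      ind (∀ u, ¬ TypQuant W P ε' (fun t => (z t).1) (v u)) +
      (ind (TypQuant W P ε' (fun t => (z t).1) (v (U v fun t => (z t).1)) ∧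
          ¬ TypSlot1 W P ε (c₁ w₁).1 (c₂ w₂).1 (fun t => (z t).2)
            (v (U v fun t => (z t).1))) +
      (ind (¬ TypSlot2 W P ε (c₁ w₁).2 (c₂ w₂).2 (r (U v fun t => (z t).1).1) y) +
      (ind (∃ s, s ≠ (U v fun t => (z t).1).1 ∧ TypBin W P ε (r s) y) +
      (ind (∃ u u', u' ≠ u ∧ u'.1 = u.1 ∧
        IsFirst finProdFinEquiv (fun a => TypQuant W P ε' (fun t => (z t).1) (v a)) u ∧
        TypDest W P ε (fun t => (z t).2) (v u')) +
      (ind (∃ w, w ≠ w₁ ∧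
      (TypSlot1 W P ε (c₁ w).1 (c₂ w₂).1 (fun t => (z t).2) (v (U v fun t => (z t).1)) ∧
      TypSlot2 W P ε (c₁ w).2 (c₂ w₂).2 (r (U v fun t => (z t).1).1) y)) +
      (ind (∃ w, w ≠ w₂ ∧
      (TypSlot1 W P ε (c₁ w₁).1 (c₂ w).1 (fun t => (z t).2) (v (U v fun t => (z t).1)) ∧
      TypSlot2 W P ε (c₁ w₁).2 (c₂ w).2 (r (U v fun t => (z t).1).1) y)) +
      ind (∃ w, w ≠ w₁ ∧ ∃ w', w' ≠ w₂ ∧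
      (TypSlot1 W P ε (c₁ w).1 (c₂ w').1 (fun t => (z t).2) (v (U v fun t => (z t).1)) ∧
      TypSlot2 W P ε (c₁ w).2 (c₂ w').2 (r (U v fun t => (z t).1).1) y)))))))) := by
  refine le_trans (ind_mono ?_) ((ind_or_le _ _).trans (add_le_add_right ((ind_or_le _ _).trans
    (add_le_add_right ((ind_or_le _ _).trans (add_le_add_right ((ind_or_le _ _).trans
    (add_le_add_right ((ind_or_le _ _).trans (add_le_add_right ((ind_or_le _ _).trans
    (add_le_add_right (ind_or_le _ _) _)) _)) _)) _)) _)) _))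
  intro hne
  by_contra hgood
  simp only [not_or] at hgood
  obtain ⟨g0, g1, g2, g3, g4, g5, g6, g7⟩ := hgood
  set u := U v fun t => (z t).1 with hu
  -- Since some index fits, the quantizer's choice is the first fitting one; this links it to the
  -- collision event, which does not mention the quantizer.
  have hfirst := hU v (fun t => (z t).1) (by push Not at g0; exact g0)
  have hslot1 : TypSlot1 W P ε (c₁ w₁).1 (c₂ w₂).1 (fun t => (z t).2) (v u) := by
    by_contra h
    exact g1 ⟨hfirst.1, h⟩
  refine hne ((schemeOf hU c₁ c₂ v r).dec_eq (u := u) hslot1 (not_not.1 g2)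
    (fun s hs h => g3 ⟨s, hs, h⟩) (fun u' h1 h2 h => g4 ⟨u, u', h1, h2, hfirst, h⟩) ?_)
  rintro ⟨w, w'⟩ hw h
  by_cases h1 : w = w₁
  · by_cases h2 : w' = w₂
    · exact hw (by rw [h1, h2])
    · subst h1
      exact g6 ⟨w', h2, h⟩
  · by_cases h2 : w' = w₂
    · subst h2
      exact g5 ⟨w, h1, h⟩
    · exact g7 ⟨w, h1, w', h2, h⟩

end

section

/-! ### Asymptotics -/

lemma tendsto_two_rpow_zero {l : ℕ → ℕ} {g : ℕ → ℝ} {c : ℝ} (hl : Tendsto l atTop atTop)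
    (hg : Tendsto g atTop (𝓝 c)) (hc : c < 0) :
    Tendsto (fun k => (2 : ℝ) ^ ((l k : ℝ) * g k)) atTop (𝓝 0) := by
  have h1 : Tendsto (fun k => (l k : ℝ) * g k) atTop atBot :=
    (tendsto_natCast_atTop_atTop.comp hl).atTop_mul_neg hc hg
  exact (tendsto_rpow_atBot_of_base_gt_one 2 one_lt_two).comp h1

lemma tendsto_two_rpow_atTop {l : ℕ → ℕ} {g : ℕ → ℝ} {c : ℝ} (hl : Tendsto l atTop atTop)
    (hg : Tendsto g atTop (𝓝 c)) (hc : 0 < c) :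
    Tendsto (fun k => (2 : ℝ) ^ ((l k : ℝ) * g k)) atTop atTop := by
  have h1 : Tendsto (fun k => (l k : ℝ) * g k) atTop atTop :=
    (tendsto_natCast_atTop_atTop.comp hl).atTop_mul_pos hc hg
  exact (tendsto_rpow_atTop_of_base_gt_one 2 one_lt_two).comp h1

lemma numIdx_ge (l : ℕ) (R : ℝ) : (2 : ℝ) ^ ((l : ℝ) * R) ≤ numIdx l R := Nat.le_ceil _

/-- Union bounds run over wrong indices only, and leaving out the correct one absorbs the rounding
up. -/
lemma numIdx_sub_one_le (l : ℕ) (R : ℝ) : (numIdx l R : ℝ) - 1 ≤ (2 : ℝ) ^ ((l : ℝ) * R) := by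
  have := Nat.ceil_lt_add_one (a := (2 : ℝ) ^ ((l : ℝ) * R)) (by positivity)
  unfold numIdx
  linarith

lemma numIdx_sub_one_nonneg (l : ℕ) (R : ℝ) : 0 ≤ (numIdx l R : ℝ) - 1 := by
  have : (1 : ℝ) ≤ numIdx l R := by
    exact_mod_cast Nat.pos_of_ne_zero (NeZero.ne (numIdx l R))
  linarith

lemma numIdx_zero (l : ℕ) : numIdx l 0 = 1 := by
  simp [numIdx]

/-! ### Exponents along sequences of slot lengths. -/

section slots

variable {β : ℝ} {n m : ℕ → ℕ}

lemma SlotLengths.tendsto_snd (h : SlotLengths β n m) :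
    Tendsto (fun k => (m k : ℝ) / ((n k + m k : ℕ) : ℝ)) atTop (𝓝 (1 - β)) := by
  refine (tendsto_const_nhds.sub h.2).congr' ?_
  filter_upwards [h.1.eventually_gt_atTop 0] with k hk
  have : ((n k + m k : ℕ) : ℝ) ≠ 0 := by exact_mod_cast hk.ne'
  field_simp
  push_cast
  ring

lemma SlotLengths.tendsto_n (h : SlotLengths β n m) (hβ : 0 < β) : Tendsto n atTop atTop := by
  have h1 := (tendsto_natCast_atTop_atTop (R := ℝ).comp h.1).atTop_mul_pos hβ h.2
  rw [← tendsto_natCast_atTop_iff (R := ℝ)]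
  refine h1.congr' ?_
  filter_upwards [h.1.eventually_gt_atTop 0] with k hk
  have : ((n k + m k : ℕ) : ℝ) ≠ 0 := by exact_mod_cast hk.ne'
  simp only [Function.comp]
  field_simp

lemma SlotLengths.tendsto_m (h : SlotLengths β n m) (hβ : β < 1) : Tendsto m atTop atTop := by
  have h1 := (tendsto_natCast_atTop_atTop (R := ℝ).comp h.1).atTop_mul_pos (sub_pos.2 hβ)
    h.tendsto_snd
  rw [← tendsto_natCast_atTop_iff (R := ℝ)]
  refine h1.congr' ?_
  filter_upwards [h.1.eventually_gt_atTop 0] with k hk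
  have : ((n k + m k : ℕ) : ℝ) ≠ 0 := by exact_mod_cast hk.ne'
  simp only [Function.comp]
  field_simp

/-- The exponents are normalised by the block length, because only the ratios of the slot lengths
converge; a strict sign of the limit then decides the behaviour of the powers of 2. -/
lemma SlotLengths.tendsto_exponent (h : SlotLengths β n m) (R a b : ℝ) :
    Tendsto (fun k => R - (n k : ℝ) / ((n k + m k : ℕ) : ℝ) * a -
      (m k : ℝ) / ((n k + m k : ℕ) : ℝ) * b) atTop (𝓝 (R - β * a - (1 - β) * b)) :=
  (tendsto_const_nhds.sub (h.2.mul_const a)).sub (h.tendsto_snd.mul_const b)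

lemma SlotLengths.mul_exponent {k : ℕ} (hk : 0 < n k + m k) (R a b : ℝ) :
    ((n k + m k : ℕ) : ℝ) * (R - (n k : ℝ) / ((n k + m k : ℕ) : ℝ) * a -
      (m k : ℝ) / ((n k + m k : ℕ) : ℝ) * b) =
    ((n k + m k : ℕ) : ℝ) * R + -(n k * a) + -(m k * b) := by
  have : ((n k + m k : ℕ) : ℝ) ≠ 0 := by exact_mod_cast hk.ne'
  field_simp
  ring

lemma SlotLengths.tendsto_rate (h : SlotLengths β n m) {R a b : ℝ}
    (hR : R < β * a + (1 - β) * b) :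
    Tendsto (fun k => (2 : ℝ) ^ (((n k + m k : ℕ) : ℝ) * R) *
      ((2 : ℝ) ^ (-(n k * a)) * (2 : ℝ) ^ (-(m k * b)))) atTop (𝓝 0) := by
  refine (tendsto_two_rpow_zero h.1 (h.tendsto_exponent R a b) (by linarith)).congr' ?_
  filter_upwards [h.1.eventually_gt_atTop 0] with k hk
  rw [SlotLengths.mul_exponent hk, Real.rpow_add two_pos, Real.rpow_add two_pos, mul_assoc]

/-- At rate 0 there is one index, so there is no wrong one and the bound is exactly 0 even without a
positive exponent. This covers the degenerate relay rates. -/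
lemma SlotLengths.tendsto_packing (h : SlotLengths β n m) {R a b : ℝ}
    (hR : R = 0 ∨ R < β * a + (1 - β) * b) :
    Tendsto (fun k => ((numIdx (n k + m k) R : ℝ) - 1) *
      ((2 : ℝ) ^ (-(n k * a)) * (2 : ℝ) ^ (-(m k * b)))) atTop (𝓝 0) := by
  rcases hR with rfl | hR
  · simp [numIdx_zero]
  · refine squeeze_zero (fun k => mul_nonneg (numIdx_sub_one_nonneg _ _) (by positivity))
      (fun k => ?_) (h.tendsto_rate hR)
    exact mul_le_mul_of_nonneg_right (numIdx_sub_one_le _ _) (by positivity)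

lemma SlotLengths.tendsto_packing₂ (h : SlotLengths β n m) {R₁ R₂ a b : ℝ}
    (hR : R₁ + R₂ < β * a + (1 - β) * b) :
    Tendsto (fun k => ((numIdx (n k + m k) R₁ : ℝ) - 1) * ((numIdx (n k + m k) R₂ : ℝ) - 1) *
      ((2 : ℝ) ^ (-(n k * a)) * (2 : ℝ) ^ (-(m k * b)))) atTop (𝓝 0) := by
  refine squeeze_zero (fun k => mul_nonneg (mul_nonneg (numIdx_sub_one_nonneg _ _)
    (numIdx_sub_one_nonneg _ _)) (by positivity)) (fun k => ?_) (h.tendsto_rate hR)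
  refine mul_le_mul_of_nonneg_right ?_ (by positivity)
  rw [mul_add, Real.rpow_add two_pos]
  exact mul_le_mul (numIdx_sub_one_le _ _) (numIdx_sub_one_le _ _) (numIdx_sub_one_nonneg _ _)
    (by positivity)

/-- The expected number of fitting indices is at least about 2^(l(RU - βa)), which grows without
bound; rounding up bins and bin sizes only helps. -/
lemma SlotLengths.tendsto_covering (h : SlotLengths β n m) (hβ : 0 < β) {RS RU a : ℝ} (K : ℝ)
    (hR : β * a < RU) :
    Tendsto (fun k => Real.exp (-((2 : ℝ) ^ (-(n k * a)) * (1 - K / n k) *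
      ((numIdx (n k + m k) RS : ℝ) * (numIdx (n k + m k) (RU - RS) : ℝ))))) atTop (𝓝 0) := by
  refine Real.tendsto_exp_atBot.comp (tendsto_neg_atTop_atBot.comp ?_)
  have h1 : Tendsto (fun k => (2 : ℝ) ^ (((n k + m k : ℕ) : ℝ) * (RU -
      (n k : ℝ) / ((n k + m k : ℕ) : ℝ) * a - (m k : ℝ) / ((n k + m k : ℕ) : ℝ) * 0)))
      atTop atTop :=
    tendsto_two_rpow_atTop h.1 (h.tendsto_exponent RU a 0) (by linarith)
  have h2 : Tendsto (fun k => 1 - K / (n k : ℝ)) atTop (𝓝 (1 - 0)) :=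
    tendsto_const_nhds.sub (tendsto_const_nhds.div_atTop
      (tendsto_natCast_atTop_atTop.comp (h.tendsto_n hβ)))
  have h3 := h1.atTop_mul_pos (by norm_num) h2
  refine tendsto_atTop_mono' _ ?_ h3
  filter_upwards [h.1.eventually_gt_atTop 0,
    h2.eventually_const_lt (show (0 : ℝ) < 1 - 0 by norm_num)] with k hk hk2
  rw [SlotLengths.mul_exponent hk, Real.rpow_add two_pos, Real.rpow_add two_pos]
  have h4 : (2 : ℝ) ^ (((n k + m k : ℕ) : ℝ) * RU) ≤
      (numIdx (n k + m k) RS : ℝ) * (numIdx (n k + m k) (RU - RS) : ℝ) := by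
    calc _ = (2 : ℝ) ^ (((n k + m k : ℕ) : ℝ) * RS) *
        (2 : ℝ) ^ (((n k + m k : ℕ) : ℝ) * (RU - RS)) := by
          rw [← Real.rpow_add two_pos, ← mul_add, add_sub_cancel]
      _ ≤ _ := mul_le_mul (numIdx_ge _ _) (numIdx_ge _ _) (by positivity) (by positivity)
  simp only [mul_zero, neg_zero, Real.rpow_zero, mul_one]
  calc _ = (2 : ℝ) ^ (-(n k * a)) * (1 - K / n k) * (2 : ℝ) ^ (((n k + m k : ℕ) : ℝ) * RU) := by
        ring
    _ ≤ _ := mul_le_mul_of_nonneg_left h4 (mul_nonneg (by positivity) hk2.le)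

end slots

/-- The rates of the relay: enough quantization indices for covering, few enough bins and few
enough indices in a bin for decoding. -/
lemma exists_relay_rates {a b c : ℝ} (h : a - b < c) : ∃ RS RU : ℝ, 0 ≤ RS ∧ RS ≤ RU ∧ a < RU ∧
    (RS = 0 ∨ RS < c) ∧ (RU - RS = 0 ∨ RU - RS < b) := by
  -- The slack is split into four parts: each rate gives up one, so the total rate still exceeds `a`
  -- by at least `2 * δ`. Truncation at 0 only increases it.
  set δ := (c + b - a) / 4 with hδ
  have hpos : 0 < δ := by rw [hδ]; linarith
  refine ⟨max 0 (c - δ), max 0 (c - δ) + max 0 (b - δ), le_max_left _ _,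
    le_add_of_nonneg_right (le_max_left _ _), ?_, ?_, ?_⟩
  · have h1 := le_max_right 0 (c - δ)
    have h2 := le_max_right 0 (b - δ)
    linarith
  · rcases max_choice 0 (c - δ) with h1 | h1
    · exact Or.inl h1
    · right; rw [h1]; linarith
  · rw [add_sub_cancel_left]
    rcases max_choice 0 (b - δ) with h1 | h1
    · exact Or.inl h1
    · right; rw [h1]; linarith

lemma eventually_lt_of_continuous {f : ℝ → ℝ} (hf : Continuous f) {a : ℝ} (h : a < f 0) :
    ∀ᶠ ε in 𝓝[>] (0 : ℝ), a < f ε :=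
  (hf.tendsto 0).eventually_const_lt h |>.filter_mono nhdsWithin_le_nhds

lemma eventually_zero_or_lt_of_continuous {f : ℝ → ℝ} (hf : Continuous f) {a : ℝ}
    (h : a = 0 ∨ a < f 0) : ∀ᶠ ε in 𝓝[>] (0 : ℝ), a = 0 ∨ a < f ε := by
  rcases h with h | h
  · exact Eventually.of_forall fun _ => Or.inl h
  · exact (eventually_lt_of_continuous hf h).mono fun _ => Or.inr

variable {X11 X21 X12 X22 XR YR Y11 Y12 Yh : Type*}
  [Fintype X11] [Fintype X21] [Fintype X12] [Fintype X22] [Fintype XR]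
  [Fintype YR] [Fintype Y11] [Fintype Y12] [Fintype Yh]
  (W : Channel X11 X21 X12 X22 XR YR Y11 Y12) (P : InputDist X11 X21 X12 X22 XR YR Yh)

/-! ### Choice of the constants and conclusion. -/

lemma errorProb_nonneg {n m M₁ M₂ : ℕ} (c : Code X11 X21 X12 X22 XR YR Y11 Y12 n m M₁ M₂) :
    0 ≤ errorProb W c := by
  rw [errorProb_eq]
  exact mul_nonneg (by positivity) (Finset.sum_nonneg fun _ _ => Finset.sum_nonneg fun _ _ =>
    expect_nonneg (out1_mem W _ _) fun _ => expect_nonneg (out2_mem W _ _ _) fun _ =>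
      ind_nonneg _)

/-- The modified compress-and-forward scheme achieves the rate region. -/
lemma cfAchievable_of_lt {β : ℝ} (hβ0 : 0 < β) (hβ1 : β < 1)
    (hrelay : β * (infoRelayQuant W P - infoDestQuant W P) < (1 - β) * infoRelayDest W P)
    {R₁ R₂ : ℝ} (h₁ : R₁ < bound1 W P β) (h₂ : R₂ < bound2 W P β)
    (hsum : R₁ + R₂ < boundSum W P β) : CFAchievable W P β R₁ R₂ := by
  obtain ⟨κB, hB⟩ := exists_packing_bin W P
  obtain ⟨κD, hD⟩ := exists_packing_dest W P
  obtain ⟨κ1, h1⟩ := exists_packing_slot1_left W P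
  obtain ⟨κ2, h2⟩ := exists_packing_slot1_right W P
  obtain ⟨κ3, h3⟩ := exists_packing_slot1_both W P
  obtain ⟨τ1, h1'⟩ := exists_packing_slot2_left W P
  obtain ⟨τ2, h2'⟩ := exists_packing_slot2_right W P
  obtain ⟨τ3, h3'⟩ := exists_packing_slot2_both W P
  obtain ⟨κC, hC⟩ := exists_covering W P
  obtain ⟨RS, RU, hRS, hRSU, hU, hS, hSU⟩ := exists_relay_rates
    (a := β * infoRelayQuant W P) (b := β * infoDestQuant W P)
    (c := (1 - β) * infoRelayDest W P) (by linarith)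
  unfold bound1 at h₁
  unfold bound2 at h₂
  unfold boundSum at hsum
  set I1 := mutualInfo (joint1 W P) (fun (x₁, _, _, _, _) => x₁)
    (fun (_, x₂, _, y, yh) => (x₂, y, yh))
  set I2 := mutualInfo (joint1 W P) (fun (_, x₂, _, _, _) => x₂)
    (fun (x₁, _, _, y, yh) => (x₁, y, yh))
  set I3 := mutualInfo (joint1 W P) (fun (x₁, x₂, _, _, _) => (x₁, x₂))
    (fun (_, _, _, y, yh) => (y, yh))
  set J1 := mutualInfo (joint2 W P) (fun (x₁, _, _, _) => x₁) (fun (_, x₂, xR, y) => (x₂, xR, y))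
  set J2 := mutualInfo (joint2 W P) (fun (_, x₂, _, _) => x₂) (fun (x₁, _, xR, y) => (x₁, xR, y))
  set J3 := mutualInfo (joint2 W P) (fun (x₁, x₂, _, _) => (x₁, x₂)) (fun (_, _, xR, y) => (xR, y))
  -- All required inequalities are strict at `ε = 0`, or concern a rate equal to 0, so they persist
  -- for small `ε`. The zero coefficients bring the one-slot tests into the two-slot form, and the
  -- last line is negated to become a lower bound.
  have ev : ∀ᶠ ε in 𝓝[>] (0 : ℝ), (0 < ε ∧ ε < 1) ∧
      R₁ < β * (I1 - ε * κ1) + (1 - β) * (J1 - ε * τ1) ∧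
      R₂ < β * (I2 - ε * κ2) + (1 - β) * (J2 - ε * τ2) ∧
      R₁ + R₂ < β * (I3 - ε * κ3) + (1 - β) * (J3 - ε * τ3) ∧
      (RS = 0 ∨ RS < β * 0 + (1 - β) * (infoRelayDest W P - ε * κB)) ∧
      (RU - RS = 0 ∨ RU - RS < β * (infoDestQuant W P - ε * κD) + (1 - β) * 0) ∧
      -RU < -(β * (infoRelayQuant W P + ε / 2 * κC)) := by
    refine Eventually.and (Ioo_mem_nhdsGT one_pos) (Eventually.and ?_ (Eventually.and ?_
      (Eventually.and ?_ (Eventually.and ?_ (Eventually.and ?_ ?_)))))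
    · exact eventually_lt_of_continuous (by fun_prop) (by linarith)
    · exact eventually_lt_of_continuous (by fun_prop) (by linarith)
    · exact eventually_lt_of_continuous (by fun_prop) (by linarith)
    · exact eventually_zero_or_lt_of_continuous (by fun_prop) (hS.imp id fun h => by linarith)
    · exact eventually_zero_or_lt_of_continuous (by fun_prop) (hSU.imp id fun h => by linarith)
    · exact eventually_lt_of_continuous (by fun_prop) (by linarith)
  obtain ⟨ε, ⟨hε0, hε1⟩, e1, e2, e3, eS, eSU, eU⟩ := ev.exists
  -- Three levels of typicality are in play: `ε / 4` for the relay reception, `ε / 2` for its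
  -- quantization, `ε` at the destination. Each gap feeds one use of conditional typicality.
  refine ⟨ε / 2, ε, RS, RU, by linarith, by linarith, hε1, hRS, hRSU, fun n m hnm => ?_⟩
  obtain ⟨K, hK⟩ := exists_avg_not_typSlot1_le W P (show ε / 2 < ε by linarith)
  set KC := chebyshevConst (compProd (lawYR W P) P.quant) (ε / 2 - ε / 4)
  set E : ℕ → ℝ := fun k =>
    (chebyshevConst (lawYR W P) (ε / 4) / n k +
      Real.exp (-((2 : ℝ) ^ (-(n k * (infoRelayQuant W P + ε / 2 * κC))) * (1 - KC / n k) *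
        ((numIdx (n k + m k) RS : ℝ) * (numIdx (n k + m k) (RU - RS) : ℝ))))) +
    (K / n k + (chebyshevConst (joint2 W P) ε / m k +
    (((numIdx (n k + m k) RS : ℝ) - 1) * ((2 : ℝ) ^ (-(n k * (0 : ℝ))) *
      (2 : ℝ) ^ (-(m k * (infoRelayDest W P - ε * κB)))) +
    (2 * (((numIdx (n k + m k) (RU - RS) : ℝ) - 1) *
      ((2 : ℝ) ^ (-(n k * (infoDestQuant W P - ε * κD))) * (2 : ℝ) ^ (-(m k * (0 : ℝ))))) +
    (((numIdx (n k + m k) R₁ : ℝ) - 1) * ((2 : ℝ) ^ (-(n k * (I1 - ε * κ1))) *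
      (2 : ℝ) ^ (-(m k * (J1 - ε * τ1)))) +
    (((numIdx (n k + m k) R₂ : ℝ) - 1) * ((2 : ℝ) ^ (-(n k * (I2 - ε * κ2))) *
      (2 : ℝ) ^ (-(m k * (J2 - ε * τ2)))) +
    ((numIdx (n k + m k) R₁ : ℝ) - 1) * ((numIdx (n k + m k) R₂ : ℝ) - 1) *
      ((2 : ℝ) ^ (-(n k * (I3 - ε * κ3))) * (2 : ℝ) ^ (-(m k * (J3 - ε * τ3)))))))))) with hE
  have hEk : ∀ k, 0 < n k → 0 < m k → ∃ c : CFScheme W P (ε / 2) (n k) (m k)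
      (numIdx (n k + m k) R₁) (numIdx (n k + m k) R₂)
      (numIdx (n k + m k) RS) (numIdx (n k + m k) (RU - RS)),
      errorProb W (c.toCode ε) ≤ E k := by
    intro k hn hm
    obtain ⟨U, hU⟩ := exists_quantizer (n := n k) (S := numIdx (n k + m k) RS)
      (B := numIdx (n k + m k) (RU - RS)) W P (ε / 2)
    refine exists_errorProb_le hU fun w₁ w₂ => ?_
    refine (avg_mono fun c₁ c₂ v z r y => ind_dec_ne_le ε hU c₁ c₂ v z r y w₁ w₂).trans ?_
    simp only [avg_add, hE]
    refine add_le_add ?_ (add_le_add ?_ (add_le_add ?_ (add_le_add ?_ (add_le_add ?_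
      (add_le_add ?_ (add_le_add ?_ ?_))))))
    · exact avg_no_cover_le (by linarith) hn fun yR hy =>
        hC (ε / 4) (ε / 2) (n k) (by linarith) hn yR hy
    · exact hK U w₁ w₂ hn
    · exact avg_not_typSlot2_le hε0 hm
    · rw [mul_zero, neg_zero, Real.rpow_zero, one_mul]
      exact avg_wrong_bin_le (hB ε (m k))
    · rw [mul_zero, neg_zero, Real.rpow_zero, mul_one, ← mul_assoc]
      exact avg_wrong_quant_le finProdFinEquiv (Nat.pos_of_ne_zero (NeZero.ne _)) (hD ε (n k))
    · exact avg_wrong_left_le (by positivity) (h1 ε (n k)) (h1' ε (m k))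
    · exact avg_wrong_right_le (by positivity) (h2 ε (n k)) (h2' ε (m k))
    · exact avg_wrong_both_le (by positivity) (h3 ε (n k)) (h3' ε (m k))
  have hn := hnm.tendsto_n hβ0
  have hm := hnm.tendsto_m hβ1
  have hlim : Tendsto E atTop (𝓝 0) := by
    have hdivn : ∀ c : ℝ, Tendsto (fun k => c / (n k : ℝ)) atTop (𝓝 0) := fun c =>
      tendsto_const_nhds.div_atTop (tendsto_natCast_atTop_atTop.comp hn)
    have hdivm : ∀ c : ℝ, Tendsto (fun k => c / (m k : ℝ)) atTop (𝓝 0) := fun c =>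
      tendsto_const_nhds.div_atTop (tendsto_natCast_atTop_atTop.comp hm)
    have := ((hdivn (chebyshevConst (lawYR W P) (ε / 4))).add
      (hnm.tendsto_covering hβ0 (RS := RS) KC (show β * _ < RU from neg_lt_neg_iff.1 eU))).add
      ((hdivn K).add ((hdivm (chebyshevConst (joint2 W P) ε)).add
      ((hnm.tendsto_packing eS).add (((hnm.tendsto_packing eSU).const_mul 2).add
      ((hnm.tendsto_packing (Or.inr e1)).add ((hnm.tendsto_packing (Or.inr e2)).add
      (hnm.tendsto_packing₂ e3)))))))
    have hz : (0 : ℝ) + 0 + (0 + (0 + (0 + (2 * 0 + (0 + (0 + 0)))))) = 0 := by norm_num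
    rw [hz] at this
    exact this
  -- A scheme is needed for every `k`, the bound only eventually, since both slot lengths tend to
  -- infinity.
  have hex : ∀ k, ∃ c : CFScheme W P (ε / 2) (n k) (m k)
      (numIdx (n k + m k) R₁) (numIdx (n k + m k) R₂)
      (numIdx (n k + m k) RS) (numIdx (n k + m k) (RU - RS)),
      0 < n k → 0 < m k → errorProb W (c.toCode ε) ≤ E k := by
    intro k
    by_cases h : 0 < n k ∧ 0 < m k
    · obtain ⟨c, hc⟩ := hEk k h.1 h.2
      exact ⟨c, fun _ _ => hc⟩
    · obtain ⟨c, -⟩ := exists_scheme (W := W) (P := P) (numIdx (n k + m k) R₁)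
        (numIdx (n k + m k) R₂) (S := numIdx (n k + m k) RS)
        (B := numIdx (n k + m k) (RU - RS)) (n k) (m k) (ε / 2) ε
      exact ⟨c, fun h1 h2 => absurd ⟨h1, h2⟩ h⟩
  choose c hc using hex
  refine ⟨c, squeeze_zero' (Eventually.of_forall fun k => errorProb_nonneg W _) ?_ hlim⟩
  filter_upwards [hn.eventually_gt_atTop 0, hm.eventually_gt_atTop 0] with k h1 h2
  exact hc k h1 h2

lemma CFAchievable.achievable {W : Channel X11 X21 X12 X22 XR YR Y11 Y12}
    {P : InputDist X11 X21 X12 X22 XR YR Yh} {β R₁ R₂ : ℝ} (h : CFAchievable W P β R₁ R₂) :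
    Achievable W β R₁ R₂ := by
  obtain ⟨ε', ε, RS, RU, -, -, -, -, -, h⟩ := h
  intro n m hnm
  obtain ⟨c, hc⟩ := h n m hnm
  exact ⟨fun k => (c k).toCode ε, hc⟩

end

end

end HDMARC

theorem theorem3
    {X11 X21 X12 X22 XR YR Y11 Y12 Yh : Type*}
    [Fintype X11] [Fintype X21] [Fintype X12] [Fintype X22] [Fintype XR]
    [Fintype YR] [Fintype Y11] [Fintype Y12] [Fintype Yh]
    (W : HDMARC.Channel X11 X21 X12 X22 XR YR Y11 Y12)
    (P : HDMARC.InputDist X11 X21 X12 X22 XR YR Yh)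
    (β : ℝ) (hβ0 : 0 < β) (hβ1 : β < 1)
    (hrelay : β * (HDMARC.infoRelayQuant W P - HDMARC.infoDestQuant W P) <
      (1 - β) * HDMARC.infoRelayDest W P)
    (R₁ R₂ : ℝ) (hR₁ : 0 ≤ R₁) (hR₂ : 0 ≤ R₂)
    (h₁ : R₁ < HDMARC.bound1 W P β) (h₂ : R₂ < HDMARC.bound2 W P β)
    (hsum : R₁ + R₂ < HDMARC.boundSum W P β) :
    HDMARC.CFAchievable W P β R₁ R₂ ∧ HDMARC.Achievable W β R₁ R₂ := by
  have h := HDMARC.cfAchievable_of_lt W P hβ0 hβ1 hrelay h₁ h₂ hsum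
  exact ⟨h, h.achievable⟩
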